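/- A real random variable is normalized if it has mean $0$ and variance $1$; a complex random variable is normalized if it equals $\frac{1}{\sqrt2}(\xi_1+i\xi_2)$ with $\xi_1,\xi_2$ iid copies of a real normalized random variable. Let $K_0>1$, $c_0>0$, $R>0$ and $K>0$. Then there are $C>0$ and $n_0$, depending only on $K_0,c_0,R,K$, such that the following holds for every $n\ge n_0$. Let $\xi$ be a normalized real or complex random variable that is sub-gaussian in the sense that $\mathbf P(|\xi|\ge t)\le c_0\exp(-t^2/K_0)$ for all $t\ge 0$, and let $M_n$ be a random $n\times n$ matrix whose entries are iid copies of $\xi$. Then with probability at least $1-n^{-K}$, every eigenvector $\mathbf x\in\mathbb C^n$ of $M_n$ with $\|\mathbf x\|_2=1$ whose eigenvalue $\lambda\in\mathbb C$ satisfies $|\lambda|\le R$ obeys $$\|\mathbf x\|_\infty\le C\sqrt{\frac{\log n}{n}}.$$ -/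

import Mathlib

open MeasureTheory ProbabilityTheory

/-- A real random variable is normalized if it has mean `0` and variance `1`. -/
def IsRealNormalized {Ω : Type*} [MeasurableSpace Ω] (η : Ω → ℝ) (P : Measure Ω) : Prop :=
  AEMeasurable η P ∧ ∫ ω, η ω ∂P = 0 ∧ variance η P = 1

/-- A complex random variable is normalized if it is `(ξ₁ + i ξ₂) / √2`, where `ξ₁`, `ξ₂` are
iid copies of a real normalized random variable. -/
def IsComplexNormalized {Ω : Type*} [MeasurableSpace Ω] (ξ : Ω → ℂ) (P : Measure Ω) : Prop :=
  ∃ ξ₁ ξ₂ : Ω → ℝ, IsRealNormalized ξ₁ P ∧ IndepFun ξ₁ ξ₂ P ∧ IdentDistrib ξ₁ ξ₂ P P ∧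
    ∀ᵐ ω ∂P, ξ ω = ((ξ₁ ω : ℂ) + Complex.I * (ξ₂ ω : ℂ)) / (Real.sqrt 2 : ℂ)

/-- A normalized random variable, real (regarded as complex-valued) or complex. -/
def IsNormalized {Ω : Type*} [MeasurableSpace Ω] (ξ : Ω → ℂ) (P : Measure Ω) : Prop :=
  (∃ η : Ω → ℝ, IsRealNormalized η P ∧ ∀ᵐ ω ∂P, ξ ω = (η ω : ℂ)) ∨ IsComplexNormalized ξ P

/-- The sub-gaussian tail bound `ℙ(|ξ| ≥ t) ≤ c₀ exp(-t² / K₀)` for all `t ≥ 0`. -/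
def IsSubgaussianWith (K₀ c₀ : ℝ) {Ω : Type*} [MeasurableSpace Ω] (ξ : Ω → ℂ)
    (P : Measure Ω) : Prop :=
  ∀ t : ℝ, 0 ≤ t → P.real {ω | t ≤ ‖ξ ω‖} ≤ c₀ * Real.exp (-t ^ 2 / K₀)

/-- The entries of the random matrix `M` are iid copies of `ξ`. -/
def HasIIDEntries {Ω₀ Ω : Type*} [MeasurableSpace Ω₀] [MeasurableSpace Ω] {n : ℕ}
    (M : Ω → Matrix (Fin n) (Fin n) ℂ) (P : Measure Ω) (ξ : Ω₀ → ℂ) (P₀ : Measure Ω₀) : Prop :=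
  iIndepFun (fun (p : Fin n × Fin n) (ω : Ω) => M ω p.1 p.2) P ∧
    ∀ i j, IdentDistrib (fun ω => M ω i j) ξ P P₀

/-- Every (complex) unit eigenvector of `A` whose eigenvalue has modulus at most `R` has
sup norm at most `b`. The norm of `x` is the Euclidean one, that of `x.ofLp` the sup norm. -/
def SmallEigenvectorsBounded {n : ℕ} (A : Matrix (Fin n) (Fin n) ℂ) (R b : ℝ) : Prop :=
  ∀ (lam : ℂ) (x : EuclideanSpace ℂ (Fin n)), ‖lam‖ ≤ R → ‖x‖ = 1 →
    Module.End.HasEigenvector (Matrix.toLin' A) lam x.ofLp → ‖x.ofLp‖ ≤ b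

/-!
Delocalization of eigenvectors of iid matrices with bounded eigenvalue.

Let `x` be a unit eigenvector of `M` with eigenvalue close to a fixed `z`, let `i` be a coordinate
at which `|xᵢ|` is large, and let `J` be a set of about `A log n` further coordinates. Let `V` be
the orthogonal complement of the columns of `M - z` outside `{i} ∪ J`; its dimension `d` exceeds
`|J|`, and it is determined by columns independent of those in `{i} ∪ J`. Projecting
`(M - z) x ≈ 0` to `V` leaves only the columns in `{i} ∪ J`, so
`|xᵢ| ‖P Mᵢ‖ ≤ ‖P M_J‖ ‖x_J‖ + O(|xᵢ| + ‖x_J‖)` (`projection_column_le`).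
Up to a probability exponentially small in `d`, `‖P Mᵢ‖ ≥ √d / 2`
(`IsParsevalFrame.measure_norm_sq_le`) and `‖P M_J‖ = O(√d)`
(`IsParsevalFrame.measure_exists_columnComb_le`); hence `‖x_J‖ ≥ c |xᵢ|`
(`measure_approxEigenSet_le`). Applying this to `≈ n / (A log n)` disjoint sets `J` and
summing squares gives `|xᵢ|² = O(log n / n)`. A union bound over `i`, over the sets `J` and over a
grid of mesh `1 / n` of values `z` costs a power of `n`, which is absorbed by taking `A` large.

The entries enter only through two properties of their law: linear functionals are subgaussian
(`SubgaussianLaw`), and the Laplace transform of `|ξ|²` has a second order expansion at zero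
(`SqNormLaplaceBound`). Both hold for centered variables of unit second absolute moment with
Gaussian tails. The small ball estimate follows from a Laplace transform bound, which is proved by
splitting `‖P c‖²` into its diagonal and an average of decoupled bilinear forms
(`card_mul_norm_sq_sum`). Gaussian averaging over `V` controls exponential moments of `‖P c‖²`
(`lintegral_eexp_sq_norm_le`), and averaging over balls of coefficient vectors replaces the
nets that are commonly used for operator norms.
-/

/-! ### Exponential moments and resampling for product measures -/

/-- The real exponential with values in `ℝ≥0∞`, so that exponential moments are Lebesgue integrals
and need no integrability hypotheses. -/
noncomputable def eexp (x : ℝ) : ENNReal := ENNReal.ofReal (Real.exp x)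

lemma eexp_add (x y : ℝ) : eexp (x + y) = eexp x * eexp y := by
  rw [eexp, Real.exp_add, ENNReal.ofReal_mul (Real.exp_pos x).le]; rfl

lemma eexp_ne_top (x : ℝ) : eexp x ≠ ⊤ := ENNReal.ofReal_ne_top

lemma eexp_ne_zero (x : ℝ) : eexp x ≠ 0 := by
  simp [eexp, Real.exp_pos]

lemma eexp_mono {x y : ℝ} (h : x ≤ y) : eexp x ≤ eexp y :=
  ENNReal.ofReal_le_ofReal (Real.exp_le_exp.2 h)

lemma eexp_sum {ι : Type*} (s : Finset ι) (f : ι → ℝ) :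
    eexp (∑ i ∈ s, f i) = ∏ i ∈ s, eexp (f i) := by
  rw [eexp, Real.exp_sum, ENNReal.ofReal_prod_of_nonneg fun i _ => (Real.exp_pos _).le]; rfl

lemma measurable_eexp : Measurable eexp :=
  ENNReal.measurable_ofReal.comp Real.measurable_exp

@[fun_prop]
lemma Measurable.eexp {α : Type*} [MeasurableSpace α] {f : α → ℝ} (hf : Measurable f) :
    Measurable fun x => eexp (f x) :=
  measurable_eexp.comp hf

/-- Integrals of products of functions of separate coordinates factor. -/
lemma lintegral_pi_prod {ι X : Type*} [Fintype ι] [MeasurableSpace X] (μ : Measure X)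
    [IsProbabilityMeasure μ] (f : ι → X → ENNReal) (hf : ∀ i, Measurable (f i)) :
    ∫⁻ y, ∏ i, f i (y i) ∂(Measure.pi fun _ : ι => μ) = ∏ i, ∫⁻ z, f i z ∂μ := by
  have hind : iIndepFun (fun (i : ι) (y : ι → X) => f i (y i)) (Measure.pi fun _ : ι => μ) :=
    iIndepFun_pi fun i => (hf i).aemeasurable
  rw [lintegral_prod_eq_prod_lintegral_of_indepFun _ _ hind
      fun i => (hf i).comp (measurable_pi_apply i)]
  refine Finset.prod_congr rfl fun i _ => ?_
  exact (measurePreserving_eval (fun _ : ι => μ) i).lintegral_comp (hf i)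

lemma lintegral_pi_eexp_sum {ι X : Type*} [Fintype ι] [MeasurableSpace X] (μ : Measure X)
    [IsProbabilityMeasure μ] (f : ι → X → ℝ) (hf : ∀ i, Measurable (f i)) :
    ∫⁻ y, eexp (∑ i, f i (y i)) ∂(Measure.pi fun _ : ι => μ) = ∏ i, ∫⁻ z, eexp (f i z) ∂μ := by
  simp_rw [eexp_sum]
  exact lintegral_pi_prod μ (fun i z => eexp (f i z)) fun i => (hf i).eexp

/-- Take the coordinates in `s` from `y` and the others from `w`. -/
def mix {ι X : Type*} [DecidableEq ι] (s : Finset ι) (p : (ι → X) × (ι → X)) : ι → X :=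
  fun i => if i ∈ s then p.1 i else p.2 i

lemma measurable_mix {ι X : Type*} [DecidableEq ι] [MeasurableSpace X] (s : Finset ι) :
    Measurable (mix s : (ι → X) × (ι → X) → ι → X) := by
  refine measurable_pi_lambda _ fun i => ?_
  by_cases h : i ∈ s
  · simp only [mix, h, if_true]; fun_prop
  · simp only [mix, h, if_false]; fun_prop

/-- Resampling a set of coordinates does not change a product measure. -/
lemma map_mix_pi {ι X : Type*} [Fintype ι] [DecidableEq ι] [MeasurableSpace X] (μ : Measure X)
    [IsProbabilityMeasure μ] (s : Finset ι) :
    ((Measure.pi fun _ : ι => μ).prod (Measure.pi fun _ : ι => μ)).map (mix s) =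
      Measure.pi fun _ : ι => μ := by
  symm
  refine Measure.pi_eq fun t ht => ?_
  rw [Measure.map_apply (measurable_mix s) (MeasurableSet.univ_pi ht)]
  have : mix s ⁻¹' Set.univ.pi t =
      (Set.univ.pi fun i => if i ∈ s then t i else Set.univ) ×ˢ
        (Set.univ.pi fun i => if i ∈ s then Set.univ else t i) := by
    ext p
    simp only [Set.mem_preimage, Set.mem_univ_pi, mix, Set.mem_prod, ← forall_and]
    refine forall_congr' fun i => ?_
    by_cases h : i ∈ s <;> simp [h]
  rw [this, Measure.prod_prod, Measure.pi_pi, Measure.pi_pi, ← Finset.prod_mul_distrib]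
  refine Finset.prod_congr rfl fun i _ => ?_
  by_cases h : i ∈ s <;> simp [h]

lemma lintegral_mix {ι X : Type*} [Fintype ι] [DecidableEq ι] [MeasurableSpace X] (μ : Measure X)
    [IsProbabilityMeasure μ] (s : Finset ι) (f : (ι → X) → ENNReal) (hf : Measurable f) :
    ∫⁻ y, f y ∂(Measure.pi fun _ : ι => μ) =
      ∫⁻ y, ∫⁻ w, f (mix s (y, w)) ∂(Measure.pi fun _ : ι => μ) ∂(Measure.pi fun _ : ι => μ) := by
  conv_lhs => rw [← map_mix_pi μ s]
  rw [lintegral_map hf (measurable_mix s),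
    lintegral_prod (fun p => f (mix s p)) (hf.comp (measurable_mix s)).aemeasurable]

/-- A measurable event is at most as likely as its worst conditional probability given the
coordinates outside `s`. -/
lemma pi_le_of_mix_le {ι X : Type*} [Fintype ι] [DecidableEq ι] [MeasurableSpace X]
    (μ : Measure X) [IsProbabilityMeasure μ] (s : Finset ι) {S : Set (ι → X)}
    (hS : MeasurableSet S) (δ : ENNReal)
    (h : ∀ w : ι → X, (Measure.pi fun _ : ι => μ) {y | mix s (y, w) ∈ S} ≤ δ) :
    (Measure.pi fun _ : ι => μ) S ≤ δ := by
  conv_lhs => rw [← map_mix_pi μ s]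
  rw [Measure.map_apply (measurable_mix s) hS, Measure.prod_apply_symm (measurable_mix s hS)]
  calc _ ≤ ∫⁻ _, δ ∂(Measure.pi fun _ : ι => μ) := lintegral_mono fun w => h w
    _ = δ := by simp

/-! ### Gaussian averaging over a complex inner product space -/

/-- Laplace transform of a Gaussian density on a finite-dimensional complex inner product space.
The measure `ν` is the volume of the underlying real inner product space; it is existentially
quantified so that the real structure does not appear in the statement. -/
lemma lintegral_eexp_neg_mul_sq_norm_add {V : Type*} [NormedAddCommGroup V]
    [InnerProductSpace ℂ V] [FiniteDimensional ℂ V] [MeasurableSpace V] [BorelSpace V] :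
    ∃ ν : Measure V, SigmaFinite ν ∧ ∀ (b : ℝ) (_ : 0 < b) (w : V),
    ∫⁻ v : V, eexp (-b * ‖v‖ ^ 2 + (inner ℂ w v).re) ∂ν =
      ENNReal.ofReal ((Real.pi / b) ^ Module.finrank ℂ V * Real.exp (‖w‖ ^ 2 / (4 * b))) := by
  let : InnerProductSpace ℝ V := InnerProductSpace.complexToReal
  have : FiniteDimensional ℝ V := FiniteDimensional.complexToReal V
  refine ⟨volume, inferInstance, fun b hb w => ?_⟩
  have hb' : 0 < (b : ℂ).re := by simpa using hb
  have h1 := GaussianFourier.integral_cexp_neg_mul_sq_norm_add hb' 1 w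
  have h2 := GaussianFourier.integrable_cexp_neg_mul_sq_norm_add hb' 1 w
  have e : ∀ v : V, Complex.exp (-(b:ℂ) * ‖v‖ ^ 2 + 1 * (inner ℝ w v : ℝ)) =
      ((Real.exp (-b * ‖v‖ ^ 2 + (inner ℂ w v).re) : ℝ) : ℂ) := by
    intro v
    have : inner ℝ w v = (inner ℂ w v).re := rfl
    rw [this]; push_cast; simp
  simp_rw [e] at h1 h2
  rw [integral_complex_ofReal] at h1
  have h3 : Integrable (fun v : V => Real.exp (-b * ‖v‖ ^ 2 + (inner ℂ w v).re)) := h2.re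
  unfold eexp
  rw [← ofReal_integral_eq_lintegral_ofReal h3
    (Filter.Eventually.of_forall fun v => (Real.exp_pos _).le)]
  congr 1
  apply Complex.ofReal_injective
  rw [h1, finrank_real_of_complex]
  have : ((2 * Module.finrank ℂ V : ℕ) / 2 : ℂ) = (Module.finrank ℂ V : ℂ) := by
    push_cast; field_simp
  rw [this, Complex.cpow_natCast]
  push_cast; simp

/-- If all linear functionals of a random vector are subgaussian, then its projection to a
`d`-dimensional subspace has norm of order `√d`, with exponential moments of the square. -/
lemma lintegral_eexp_sq_norm_le {Ω V : Type*} [MeasurableSpace Ω] (P : Measure Ω)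
    [IsProbabilityMeasure P] [NormedAddCommGroup V]
    [InnerProductSpace ℂ V] [FiniteDimensional ℂ V] [MeasurableSpace V] [BorelSpace V]
    (f : Ω → V) (hf : Measurable f) (κ : ℝ) (hκ : 0 < κ)
    (h : ∀ v : V, ∫⁻ ω, eexp (inner ℂ (f ω) v).re ∂P ≤ eexp (κ * ‖v‖ ^ 2)) :
    ∫⁻ ω, eexp (‖f ω‖ ^ 2 / (8 * κ)) ∂P ≤ 2 ^ Module.finrank ℂ V := by
  obtain ⟨ν, hν, hG⟩ := lintegral_eexp_neg_mul_sq_norm_add (V := V)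
  set d := Module.finrank ℂ V
  have : ProperSpace V := FiniteDimensional.proper ℂ V
  have hpos : 0 < (Real.pi / (2 * κ)) ^ d := by positivity
  have hc0 : ENNReal.ofReal ((Real.pi / (2 * κ)) ^ d) ≠ 0 := by simpa using hpos
  have hct : ENNReal.ofReal ((Real.pi / (2 * κ)) ^ d) ≠ ⊤ := ENNReal.ofReal_ne_top
  -- Up to normalization, `exp (‖w‖² / (8κ))` is the average of `exp (Re ⟪w, v⟫)` over a
  -- Gaussian `v`.
  have key : ENNReal.ofReal ((Real.pi / (2 * κ)) ^ d) * ∫⁻ ω, eexp (‖f ω‖ ^ 2 / (8 * κ)) ∂P ≤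
      ENNReal.ofReal ((Real.pi / (2 * κ)) ^ d) * 2 ^ d := by
    calc _ = ∫⁻ ω, ∫⁻ v, eexp (-(2 * κ) * ‖v‖ ^ 2 + (inner ℂ (f ω) v).re) ∂ν ∂P := by
          rw [← lintegral_const_mul _ (by fun_prop)]
          refine lintegral_congr fun ω => ?_
          rw [hG _ (by positivity), ENNReal.ofReal_mul hpos.le, eexp]
          congr 4; ring
      _ = ∫⁻ v, ∫⁻ ω, eexp (-(2 * κ) * ‖v‖ ^ 2 + (inner ℂ (f ω) v).re) ∂P ∂ν := by
          refine lintegral_lintegral_swap ?_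
          refine (Measurable.eexp ?_).aemeasurable
          refine Measurable.add (by fun_prop) ?_
          exact Complex.measurable_re.comp ((hf.comp measurable_fst).inner measurable_snd)
      _ ≤ ∫⁻ v, eexp (-κ * ‖v‖ ^ 2 + (inner ℂ (0 : V) v).re) ∂ν := by
          refine lintegral_mono fun v => ?_
          simp_rw [eexp_add]
          rw [lintegral_const_mul' _ _ (eexp_ne_top _)]
          refine (mul_le_mul_right (h v) _).trans ?_
          rw [← eexp_add, ← eexp_add]
          refine eexp_mono ?_
          simp; ring_nf; rfl
      _ = _ := by
          rw [hG _ hκ, ← ENNReal.ofReal_ofNat, ← ENNReal.ofReal_pow (by norm_num),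
            ← ENNReal.ofReal_mul hpos.le, ← mul_pow]
          simp only [norm_zero]
          congr 1
          have : Real.pi / (2 * κ) * 2 = Real.pi / κ := by field_simp
          rw [this]; simp
  exact (ENNReal.mul_le_mul_iff_right hc0 hct).1 key

/-! ### Jensen's inequality and decoupling of quadratic forms -/

/-- Jensen's inequality `E exp(θ f) ≤ (E exp f) ^ θ` for `θ ∈ [0, 1]`. -/
lemma lintegral_eexp_mul_le {Ω : Type*} [MeasurableSpace Ω] {P : Measure Ω}
    [IsProbabilityMeasure P] {f : Ω → ℝ} {A θ : ℝ} (h0 : 0 ≤ θ) (h1 : θ ≤ 1)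
    (h : ∫⁻ ω, eexp (f ω) ∂P ≤ eexp A) : ∫⁻ ω, eexp (θ * f ω) ∂P ≤ eexp (θ * A) := by
  have key : ∀ ω, eexp (θ * f ω) ≤ ENNReal.ofReal (1 - θ) * eexp (θ * A) +
      ENNReal.ofReal θ * eexp (θ * A - A) * eexp (f ω) := by
    intro ω
    have hc := convexOn_exp.2 (Set.mem_univ (θ * A)) (Set.mem_univ (f ω - A + θ * A))
      (sub_nonneg.2 h1) h0 (by ring)
    have e : (1 - θ) • (θ * A) + θ • (f ω - A + θ * A) = θ * f ω := by
      simp only [smul_eq_mul]; ring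
    rw [e] at hc
    rw [mul_assoc, ← eexp_add]
    simp only [eexp]
    rw [← ENNReal.ofReal_mul (sub_nonneg.2 h1), ← ENNReal.ofReal_mul h0,
      ← ENNReal.ofReal_add (mul_nonneg (sub_nonneg.2 h1) (Real.exp_pos _).le)
        (mul_nonneg h0 (Real.exp_pos _).le)]
    refine ENNReal.ofReal_le_ofReal (hc.trans_eq ?_)
    simp only [smul_eq_mul]
    congr 3; ring
  calc _ ≤ ∫⁻ ω, (ENNReal.ofReal (1 - θ) * eexp (θ * A) +
      ENNReal.ofReal θ * eexp (θ * A - A) * eexp (f ω)) ∂P := lintegral_mono key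
    _ = ENNReal.ofReal (1 - θ) * eexp (θ * A) +
      ENNReal.ofReal θ * eexp (θ * A - A) * ∫⁻ ω, eexp (f ω) ∂P := by
        rw [lintegral_add_left measurable_const, lintegral_const_mul'
          _ _ (ENNReal.mul_ne_top ENNReal.ofReal_ne_top (eexp_ne_top _))]
        simp
    _ ≤ ENNReal.ofReal (1 - θ) * eexp (θ * A) +
      ENNReal.ofReal θ * eexp (θ * A - A) * eexp A := by gcongr
    _ = eexp (θ * A) := by
        rw [mul_assoc, ← eexp_add, sub_add_cancel, ← add_mul,
          ← ENNReal.ofReal_add (sub_nonneg.2 h1) h0]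
        simp

lemma two_pow_le_eexp (d : ℕ) : (2 : ENNReal) ^ d ≤ eexp d := by
  have h2 : (2 : ℝ) ≤ Real.exp 1 := by
    have := Real.add_one_le_exp (1 : ℝ); linarith
  rw [eexp, ← ENNReal.ofReal_ofNat, ← ENNReal.ofReal_pow (by norm_num)]
  refine ENNReal.ofReal_le_ofReal ?_
  calc (2 : ℝ) ^ d ≤ Real.exp 1 ^ d := by gcongr
    _ = Real.exp d := by rw [← Real.exp_nat_mul, mul_one]

/-- Jensen's inequality for the exponential and a finite average. -/
lemma card_mul_eexp_le {α : Type*} (s : Finset α) (f : α → ℝ) (m : ℝ)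
    (hm : (s.card : ℝ) * m = ∑ a ∈ s, f a) :
    (s.card : ENNReal) * eexp m ≤ ∑ a ∈ s, eexp (f a) := by
  unfold eexp
  rw [← ENNReal.ofReal_natCast, ← ENNReal.ofReal_mul (Nat.cast_nonneg _),
    ← ENNReal.ofReal_sum_of_nonneg fun i _ => (Real.exp_pos _).le]
  refine ENNReal.ofReal_le_ofReal ?_
  have : ∀ a ∈ s, Real.exp m * (1 + (f a - m)) ≤ Real.exp (f a) := by
    intro a _
    calc Real.exp m * (1 + (f a - m)) ≤ Real.exp m * Real.exp (f a - m) := by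
          gcongr; linarith [Real.add_one_le_exp (f a - m)]
      _ = Real.exp (f a) := by rw [← Real.exp_add]; congr 1; ring
  refine le_trans (le_of_eq ?_) (Finset.sum_le_sum this)
  rw [← Finset.mul_sum, Finset.sum_add_distrib, Finset.sum_sub_distrib, ← hm]
  simp; ring

lemma two_mul_eexp_add_le (a b : ℝ) : 2 * eexp (a + b) ≤ eexp (2 * a) + eexp (2 * b) := by
  have := card_mul_eexp_le (Finset.univ : Finset Bool) (fun i => if i then 2 * a else 2 * b) (a + b)
    (by simp; ring)
  simpa using this

section Signs
variable {ι F : Type*} [DecidableEq ι] [NormedAddCommGroup F] [InnerProductSpace ℂ F]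

/-- Averaging `‖a + ∑ ± zᵢ‖²` over all signs. -/
lemma sum_powerset_norm_sq (z : ι → F) (s : Finset ι) (a : F) :
    ∑ δ ∈ s.powerset, ‖a + (∑ i ∈ δ, z i - ∑ i ∈ s \ δ, z i)‖ ^ 2 =
      2 ^ s.card * (‖a‖ ^ 2 + ∑ i ∈ s, ‖z i‖ ^ 2) := by
  induction s using Finset.induction_on generalizing a with
  | empty => simp
  | insert i s hi ih =>
    rw [Finset.sum_powerset_insert hi]
    have h1 : ∀ δ ∈ s.powerset, ‖a + (∑ j ∈ δ, z j - ∑ j ∈ insert i s \ δ, z j)‖ ^ 2 =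
        ‖(a - z i) + (∑ j ∈ δ, z j - ∑ j ∈ s \ δ, z j)‖ ^ 2 := by
      intro δ hδ
      have hid : i ∉ δ := fun h => hi (Finset.mem_powerset.1 hδ h)
      rw [Finset.insert_sdiff_of_notMem _ hid, Finset.sum_insert (by simp [hi])]
      congr 2; abel
    have h2 : ∀ δ ∈ s.powerset,
        ‖a + (∑ j ∈ insert i δ, z j - ∑ j ∈ insert i s \ insert i δ, z j)‖ ^ 2 =
        ‖(a + z i) + (∑ j ∈ δ, z j - ∑ j ∈ s \ δ, z j)‖ ^ 2 := by
      intro δ hδ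
      have hid : i ∉ δ := fun h => hi (Finset.mem_powerset.1 hδ h)
      have : insert i s \ insert i δ = s \ δ := by
        ext j; simp only [Finset.mem_sdiff, Finset.mem_insert]
        constructor
        · rintro ⟨rfl | h, h'⟩
          · simp at h'
          · exact ⟨h, fun h'' => h' (Or.inr h'')⟩
        · rintro ⟨h, h'⟩
          refine ⟨Or.inr h, ?_⟩
          rintro (rfl | h'')
          · exact hi h
          · exact h' h''
      rw [this, Finset.sum_insert hid]
      congr 2; abel
    rw [Finset.sum_congr rfl h1, Finset.sum_congr rfl h2, ih, ih, Finset.card_insert_of_notMem hi,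
      Finset.sum_insert hi]
    have := parallelogram_law_with_norm ℂ a (z i)
    rw [pow_succ]
    linear_combination (2 : ℝ) ^ s.card * this

/-- Decoupling: the square of the norm of a sum is its diagonal part plus four times the average
over all bipartitions of the interaction between the two parts. -/
lemma card_mul_norm_sq_sum [Fintype ι] (z : ι → F) :
    ((Finset.univ : Finset (Finset ι)).card : ℝ) * ‖∑ i, z i‖ ^ 2 =
      ∑ δ : Finset ι, (∑ i, ‖z i‖ ^ 2 + 4 * (inner ℂ (∑ i ∈ δ, z i) (∑ i ∈ δᶜ, z i)).re) := by
  have h := sum_powerset_norm_sq z Finset.univ 0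
  simp only [Finset.powerset_univ, zero_add, norm_zero, ← Finset.compl_eq_univ_sdiff] at h
  have e : ∀ δ : Finset ι, 4 * (inner ℂ (∑ i ∈ δ, z i) (∑ i ∈ δᶜ, z i)).re =
      ‖∑ i, z i‖ ^ 2 - ‖∑ i ∈ δ, z i - ∑ i ∈ δᶜ, z i‖ ^ 2 := by
    intro δ
    rw [← Finset.sum_add_sum_compl δ z, norm_add_sq (𝕜 := ℂ), norm_sub_sq (𝕜 := ℂ)]
    simp only [RCLike.re_eq_complex_re]; ring
  simp_rw [e]
  rw [Finset.sum_add_distrib, Finset.sum_sub_distrib, h]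
  simp
end Signs

/-! ### Small ball estimate for projected random vectors -/

/-- All real linear functionals of a complex random variable with law `μ` are subgaussian,
with variance proxy `2κ`. -/
def SubgaussianLaw (κ : ℝ) (μ : Measure ℂ) : Prop :=
  ∀ a : ℂ, ∫⁻ z, eexp (a * z).re ∂μ ≤ eexp (κ * ‖a‖ ^ 2)

/-- A second order bound for the Laplace transform of `|z|²`, where `z` has law `μ`; the linear
term expresses that `|z|²` has mean at least `1`. -/
def SqNormLaplaceBound (L : ℝ) (μ : Measure ℂ) : Prop :=
  ∀ s : ℝ, 0 ≤ s → ∫⁻ z, eexp (-(s * ‖z‖ ^ 2)) ∂μ ≤ eexp (-s + L * s ^ 2)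

lemma lintegral_eexp_linear_le {ι : Type*} [Fintype ι] {κ : ℝ} {μ : Measure ℂ}
    [IsProbabilityMeasure μ] (hμ : SubgaussianLaw κ μ) (b : ι → ℂ) :
    ∫⁻ x, eexp (∑ i, (b i * x i).re) ∂(Measure.pi fun _ : ι => μ) ≤
      eexp (κ * ∑ i, ‖b i‖ ^ 2) := by
  rw [lintegral_pi_eexp_sum μ (fun i z => (b i * z).re) (fun i => by fun_prop), Finset.mul_sum,
    eexp_sum]
  exact Finset.prod_le_prod' fun i _ => hμ (b i)

section Frame
variable {ι V : Type*} [Fintype ι] [NormedAddCommGroup V] [InnerProductSpace ℂ V]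

/-- A Parseval frame of `V`. The projections to `V` of an orthonormal basis of a larger space are of
this kind, and working with them makes `V` an abstract space rather than a subspace. -/
def IsParsevalFrame (p : ι → V) : Prop :=
  ∀ v : V, ∑ i, ‖inner ℂ v (p i)‖ ^ 2 = ‖v‖ ^ 2

lemma IsParsevalFrame.norm_le_one {p : ι → V} (hp : IsParsevalFrame p) (i : ι) : ‖p i‖ ≤ 1 := by
  have h1 : ‖inner ℂ (p i) (p i)‖ ^ 2 ≤ ‖p i‖ ^ 2 := by
    rw [← hp (p i)]
    exact Finset.single_le_sum (f := fun j => ‖inner ℂ (p i) (p j)‖ ^ 2)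
      (fun _ _ => by positivity) (Finset.mem_univ i)
  rw [inner_self_eq_norm_sq_to_K] at h1
  simp only [norm_pow, RCLike.norm_ofReal, abs_norm] at h1
  by_contra! h
  nlinarith [mul_pos (sub_pos.2 h) (sub_pos.2 h)]

lemma IsParsevalFrame.sum_norm_sq [FiniteDimensional ℂ V] {p : ι → V} (hp : IsParsevalFrame p) :
    ∑ i, ‖p i‖ ^ 2 = Module.finrank ℂ V := by
  have h : ∀ i, ‖p i‖ ^ 2 = ∑ k, ‖inner ℂ (stdOrthonormalBasis ℂ V k) (p i)‖ ^ 2 := fun i =>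
    ((stdOrthonormalBasis ℂ V).sum_sq_norm_inner_right (p i)).symm
  simp_rw [h]
  rw [Finset.sum_comm]
  simp [hp _]

/-- Linear functionals of a random combination of frame vectors are subgaussian. -/
lemma IsParsevalFrame.lintegral_eexp_inner_le {p : ι → V} (hp : IsParsevalFrame p) {κ : ℝ}
    (hκ : 0 < κ) {μ : Measure ℂ} [IsProbabilityMeasure μ] (hμ : SubgaussianLaw κ μ)
    (δ : Finset ι) (v : V) :
    ∫⁻ x, eexp (inner ℂ (∑ i ∈ δ, x i • p i) v).re ∂(Measure.pi fun _ : ι => μ) ≤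
      eexp (κ * ‖v‖ ^ 2) := by
  classical
  have e : ∀ x : ι → ℂ, (inner ℂ (∑ i ∈ δ, x i • p i) v).re =
      ∑ i, ((if i ∈ δ then inner ℂ v (p i) else 0) * x i).re := by
    intro x
    simp_rw [ite_mul, zero_mul, apply_ite Complex.re, Complex.zero_re]
    rw [Finset.sum_ite_mem, Finset.univ_inter, ← Complex.re_sum, ← inner_conj_symm, Complex.conj_re,
      inner_sum]
    simp_rw [inner_smul_right, mul_comm]
  simp_rw [e]
  refine (lintegral_eexp_linear_le hμ _).trans (eexp_mono ?_)
  gcongr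
  rw [← hp v]
  refine Finset.sum_le_sum fun i _ => ?_
  split_ifs
  · exact le_rfl
  · simp

lemma measurable_frame_sum [MeasurableSpace V] [BorelSpace V] (p : ι → V) (δ : Finset ι) :
    Measurable fun x : ι → ℂ => ∑ i ∈ δ, x i • p i := by
  have : Continuous fun x : ι → ℂ => ∑ i ∈ δ, x i • p i := by fun_prop
  exact this.measurable

lemma IsParsevalFrame.lintegral_eexp_sq_le [FiniteDimensional ℂ V]
    {p : ι → V} (hp : IsParsevalFrame p) {κ : ℝ}
    (hκ : 0 < κ) {μ : Measure ℂ} [IsProbabilityMeasure μ] (hμ : SubgaussianLaw κ μ)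
    (δ : Finset ι) {θ : ℝ} (h0 : 0 ≤ θ) (h1 : θ ≤ 1) :
    ∫⁻ x, eexp (θ * (‖∑ i ∈ δ, x i • p i‖ ^ 2 / (8 * κ))) ∂(Measure.pi fun _ : ι => μ) ≤
      eexp (θ * Module.finrank ℂ V) := by
  borelize V
  refine lintegral_eexp_mul_le h0 h1 (le_trans ?_ (two_pow_le_eexp _))
  exact lintegral_eexp_sq_norm_le _ _ (measurable_frame_sum p δ) κ hκ
    (hp.lintegral_eexp_inner_le hκ hμ δ)

/-- The decoupled interaction between two complementary sets of coordinates has a Laplace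
transform of second order. -/
lemma IsParsevalFrame.lintegral_eexp_decoupled_le [DecidableEq ι] [FiniteDimensional ℂ V]
    {p : ι → V} (hp : IsParsevalFrame p) {κ : ℝ}
    (hκ : 0 < κ) {μ : Measure ℂ} [IsProbabilityMeasure μ] (hμ : SubgaussianLaw κ μ)
    (δ : Finset ι) {s : ℝ} (hs : 512 * κ ^ 2 * s ^ 2 ≤ 1) :
    ∫⁻ x, eexp (-(8 * s) * (inner ℂ (∑ i ∈ δ, x i • p i) (∑ i ∈ δᶜ, x i • p i)).re)
        ∂(Measure.pi fun _ : ι => μ) ≤ eexp (512 * κ ^ 2 * s ^ 2 * Module.finrank ℂ V) := by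
  have hm : Measurable fun x : ι → ℂ =>
      eexp (-(8 * s) * (inner ℂ (∑ i ∈ δ, x i • p i) (∑ i ∈ δᶜ, x i • p i)).re) := by
    refine Measurable.eexp (Continuous.measurable ?_)
    refine continuous_const.mul (Complex.continuous_re.comp ?_)
    exact Continuous.inner (by fun_prop) (by fun_prop)
  -- The coordinates outside `δ` may be resampled independently; given those in `δ`, the bilinear
  -- form is a linear functional of the resampled ones.
  rw [lintegral_mix μ δ _ hm]
  refine le_trans (lintegral_mono fun y => ?_) (hp.lintegral_eexp_sq_le hκ hμ δ (by positivity) hs)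
  have e1 : ∀ w, ∑ i ∈ δ, mix δ (y, w) i • p i = ∑ i ∈ δ, y i • p i := fun w =>
    Finset.sum_congr rfl fun i hi => by simp [mix, hi]
  have e2 : ∀ w, ∑ i ∈ δᶜ, mix δ (y, w) i • p i = ∑ i ∈ δᶜ, w i • p i := fun w =>
    Finset.sum_congr rfl fun i hi => by simp [mix, Finset.mem_compl.1 hi]
  simp_rw [e1, e2]
  set u := ∑ i ∈ δ, y i • p i
  have e3 : ∀ w : ι → ℂ, -(8 * s) * (inner ℂ u (∑ i ∈ δᶜ, w i • p i)).re =
      (inner ℂ (∑ i ∈ δᶜ, w i • p i) ((-(8 * s) : ℂ) • u)).re := by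
    intro w
    rw [inner_smul_right, ← inner_conj_symm, Complex.conj_re]
    simp
  simp_rw [e3]
  refine (hp.lintegral_eexp_inner_le hκ hμ δᶜ _).trans (eexp_mono (le_of_eq ?_))
  rw [norm_smul, mul_pow]
  have : ‖(-(8 * s) : ℂ)‖ ^ 2 = 64 * s ^ 2 := by
    rw [norm_neg, norm_mul, mul_pow, Complex.norm_real, Real.norm_eq_abs, sq_abs]; norm_num
  rw [this]
  field_simp
  ring

/-- The diagonal part has mean `d` and a Laplace transform of second order. -/
lemma IsParsevalFrame.lintegral_eexp_diagonal_le [FiniteDimensional ℂ V] {p : ι → V}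
    (hp : IsParsevalFrame p) {L : ℝ} (hL : 0 ≤ L)
    {μ : Measure ℂ} [IsProbabilityMeasure μ] (hμ : SqNormLaplaceBound L μ) {s : ℝ} (hs : 0 ≤ s) :
    ∫⁻ x, eexp (-(2 * s) * (∑ i, ‖x i • p i‖ ^ 2 - Module.finrank ℂ V))
        ∂(Measure.pi fun _ : ι => μ) ≤ eexp (4 * L * s ^ 2 * Module.finrank ℂ V) := by
  have e : ∀ x : ι → ℂ, -(2 * s) * (∑ i, ‖x i • p i‖ ^ 2 - Module.finrank ℂ V) =
      2 * s * Module.finrank ℂ V + ∑ i, -((2 * s * ‖p i‖ ^ 2) * ‖x i‖ ^ 2) := by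
    intro x
    rw [mul_sub, Finset.mul_sum, neg_mul, sub_neg_eq_add, add_comm]
    congr 1
    refine Finset.sum_congr rfl fun i _ => ?_
    rw [norm_smul, mul_pow]; ring
  simp_rw [e, eexp_add]
  rw [lintegral_const_mul' _ _ (eexp_ne_top _),
    lintegral_pi_eexp_sum μ (fun i z => -((2 * s * ‖p i‖ ^ 2) * ‖z‖ ^ 2)) (fun i => by fun_prop)]
  refine (mul_le_mul_right (Finset.prod_le_prod' fun i _ => hμ (2 * s * ‖p i‖ ^ 2)
    (by positivity)) _).trans ?_
  rw [← eexp_sum, ← eexp_add]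
  refine eexp_mono ?_
  rw [← hp.sum_norm_sq, Finset.mul_sum, Finset.mul_sum, ← Finset.sum_add_distrib]
  refine Finset.sum_le_sum fun i _ => ?_
  have h1 := hp.norm_le_one i
  have h2 : ‖p i‖ ^ 2 ≤ 1 := pow_le_one₀ (norm_nonneg _) h1
  have h3 : 0 ≤ L * s ^ 2 * ‖p i‖ ^ 2 * (1 - ‖p i‖ ^ 2) :=
    mul_nonneg (by positivity) (sub_nonneg.2 h2)
  nlinarith

/-- Laplace transform bound for the squared norm of a projected vector with independent
coordinates. -/
lemma IsParsevalFrame.lintegral_eexp_neg_sq_le [FiniteDimensional ℂ V]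
    {p : ι → V} (hp : IsParsevalFrame p) {κ L : ℝ}
    (hκ : 0 < κ) (hL : 0 ≤ L) {μ : Measure ℂ} [IsProbabilityMeasure μ]
    (hμ : SubgaussianLaw κ μ) (hμ' : SqNormLaplaceBound L μ)
    {s : ℝ} (hs0 : 0 ≤ s) (hs : 512 * κ ^ 2 * s ^ 2 ≤ 1) :
    ∫⁻ x, eexp (-s * ‖∑ i, x i • p i‖ ^ 2) ∂(Measure.pi fun _ : ι => μ) ≤
      eexp ((-s + (4 * L + 512 * κ ^ 2) * s ^ 2) * Module.finrank ℂ V) := by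
  set d : ℝ := (Module.finrank ℂ V : ℝ)
  have hd : 0 ≤ d := Nat.cast_nonneg _
  classical
  set N : ENNReal := ((Finset.univ : Finset (Finset ι)).card : ENNReal)
  have hN0 : N ≠ 0 := by
    simp only [N, ne_eq, Nat.cast_eq_zero, Finset.card_eq_zero]
    exact Finset.univ_nonempty.ne_empty
  have hNt : N ≠ ⊤ := ENNReal.natCast_ne_top _
  set f : (ι → ℂ) → ℝ := fun x => -(s) * (∑ i, ‖x i • p i‖ ^ 2 - d)
  set g : Finset ι → (ι → ℂ) → ℝ := fun δ x =>
    -(4 * s) * (inner ℂ (∑ i ∈ δ, x i • p i) (∑ i ∈ δᶜ, x i • p i)).re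
  set B := eexp ((4 * L + 512 * κ ^ 2) * s ^ 2 * d)
  have hfm : Measurable fun x => eexp (2 * f x) := by
    refine Measurable.eexp (Continuous.measurable ?_)
    fun_prop
  have h1 : ∀ x : ι → ℂ, N * eexp (-s * ‖∑ i, x i • p i‖ ^ 2) ≤
      ∑ δ : Finset ι, eexp (-s * d) * eexp (f x + g δ x) := by
    intro x
    have h := card_mul_norm_sq_sum fun i => x i • p i
    refine (card_mul_eexp_le Finset.univ (fun δ : Finset ι => -s * d + (f x + g δ x)) _ ?_).trans
      (le_of_eq ?_)
    · rw [mul_left_comm, h, Finset.mul_sum]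
      refine Finset.sum_congr rfl fun δ _ => ?_
      simp only [f, g]; ring
    · exact Finset.sum_congr rfl fun δ _ => eexp_add _ _
  -- The diagonal part `f` and the interaction `g δ` are dependent; they are separated by
  -- `2 exp (a + b) ≤ exp (2 a) + exp (2 b)`, which loses nothing to first order in `s`, since both
  -- parts have been centered.
  have h2 : ∀ δ : Finset ι, ∫⁻ x, eexp (f x + g δ x) ∂(Measure.pi fun _ : ι => μ) ≤ B := by
    intro δ
    have h3 : 2 * ∫⁻ x, eexp (f x + g δ x) ∂(Measure.pi fun _ : ι => μ) ≤ 2 * B := by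
      rw [← lintegral_const_mul' _ _ (by norm_num)]
      refine (lintegral_mono fun x => two_mul_eexp_add_le (f x) (g δ x)).trans ?_
      rw [lintegral_add_left hfm, two_mul]
      refine add_le_add ?_ ?_
      · have := hp.lintegral_eexp_diagonal_le hL hμ' hs0
        refine (le_trans (le_of_eq ?_) this).trans (eexp_mono ?_)
        · refine lintegral_congr fun x => ?_
          congr 1; simp only [f]; ring
        · gcongr; nlinarith [sq_nonneg κ]
      · have := hp.lintegral_eexp_decoupled_le hκ hμ δ hs
        refine (le_trans (le_of_eq ?_) this).trans (eexp_mono ?_)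
        · refine lintegral_congr fun x => ?_
          congr 1; simp only [g]; ring
        · gcongr; nlinarith [sq_nonneg s, mul_nonneg hL (sq_nonneg s)]
    exact (ENNReal.mul_le_mul_iff_right (by norm_num) (by norm_num)).1 h3
  have hgm : ∀ δ, Measurable fun x => eexp (-s * d) * eexp (f x + g δ x) := by
    intro δ
    refine Measurable.const_mul (Measurable.eexp (Continuous.measurable ?_)) _
    refine Continuous.add (by fun_prop) (continuous_const.mul (Complex.continuous_re.comp ?_))
    exact Continuous.inner (by fun_prop) (by fun_prop)
  refine (ENNReal.mul_le_mul_iff_right hN0 hNt).1 ?_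
  rw [← lintegral_const_mul' _ _ hNt]
  calc _ ≤ ∫⁻ x, ∑ δ : Finset ι, eexp (-s * d) * eexp (f x + g δ x)
          ∂(Measure.pi fun _ : ι => μ) := lintegral_mono h1
    _ = ∑ δ : Finset ι, eexp (-s * d) * ∫⁻ x, eexp (f x + g δ x)
          ∂(Measure.pi fun _ : ι => μ) := by
        rw [lintegral_finsetSum _ fun δ _ => hgm δ]
        exact Finset.sum_congr rfl fun δ _ => lintegral_const_mul' _ _ (eexp_ne_top _)
    _ ≤ ∑ δ : Finset ι, eexp (-s * d) * B := by gcongr with δ; exact h2 δ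
    _ = _ := by
        rw [Finset.sum_const, nsmul_eq_mul, ← eexp_add]
        congr 2; ring

/-- Small ball estimate: a `d`-dimensional projection of a random vector is unlikely to have
norm below `√d / 2`. -/
lemma IsParsevalFrame.measure_norm_sq_le [FiniteDimensional ℂ V]
    {p : ι → V} (hp : IsParsevalFrame p) {κ L : ℝ}
    (hκ : 0 < κ) (hL : 0 ≤ L) {μ : Measure ℂ} [IsProbabilityMeasure μ]
    (hμ : SubgaussianLaw κ μ) (hμ' : SqNormLaplaceBound L μ)
    {s : ℝ} (hs0 : 0 ≤ s) (hs : (4 * L + 512 * κ ^ 2) * s ≤ 1 / 4) (hs1 : s ≤ 1) :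
    (Measure.pi fun _ : ι => μ) {x | ‖∑ i, x i • p i‖ ^ 2 ≤ Module.finrank ℂ V / 4} ≤
      eexp (-(s / 2) * Module.finrank ℂ V) := by
  set d : ℝ := (Module.finrank ℂ V : ℝ)
  have hd : 0 ≤ d := Nat.cast_nonneg _
  have hs' : 512 * κ ^ 2 * s ^ 2 ≤ 1 := by
    have : 512 * κ ^ 2 * s ≤ 1 := by nlinarith [mul_nonneg hL hs0]
    nlinarith
  have h := hp.lintegral_eexp_neg_sq_le hκ hL hμ hμ' hs0 hs'
  have hm : Measurable fun x : ι → ℂ => eexp (-s * ‖∑ i, x i • p i‖ ^ 2) := by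
    refine Measurable.eexp (Continuous.measurable ?_); fun_prop
  have hmk := mul_meas_ge_le_lintegral (μ := Measure.pi fun _ : ι => μ) hm (eexp (-s * (d / 4)))
  have hsub : {x : ι → ℂ | ‖∑ i, x i • p i‖ ^ 2 ≤ d / 4} ⊆
      {x | eexp (-s * (d / 4)) ≤ eexp (-s * ‖∑ i, x i • p i‖ ^ 2)} := by
    intro x hx
    refine eexp_mono ?_
    have := mul_le_mul_of_nonneg_left (show ‖∑ i, x i • p i‖ ^ 2 ≤ d / 4 from hx) hs0
    linarith
  refine (ENNReal.mul_le_mul_iff_right (eexp_ne_zero (-s * (d / 4))) (eexp_ne_top _)).1 ?_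
  rw [← eexp_add]
  refine (mul_le_mul_right (measure_mono hsub) _).trans (hmk.trans (h.trans (eexp_mono ?_)))
  have h5 : (4 * L + 512 * κ ^ 2) * s ^ 2 ≤ 1 / 4 * s := by
    nlinarith
  nlinarith

end Frame

/-! ### Operator norm of projected random matrices -/

/-- Selecting distinct coordinates of a random vector with independent identically distributed
coordinates gives a vector of the same kind. -/
lemma map_comp_pi {ι ι' X : Type*} [Fintype ι] [Fintype ι'] [MeasurableSpace X] (μ : Measure X)
    [IsProbabilityMeasure μ] {f : ι' → ι} (hf : f.Injective) :
    (Measure.pi fun _ : ι => μ).map (fun y i => y (f i)) = Measure.pi fun _ : ι' => μ := by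
  have h : iIndepFun (fun (i : ι) (y : ι → X) => y i) (Measure.pi fun _ : ι => μ) :=
    iIndepFun_pi (X := fun _ => id) fun _ => aemeasurable_id
  have h2 := (iIndepFun_iff_map_fun_eq_pi_map
    fun i => (measurable_pi_apply (f i)).aemeasurable).1 (h.precomp hf)
  refine h2.trans ?_
  congr 1
  ext1 i
  exact (measurePreserving_eval (fun _ : ι => μ) (f i)).map_eq

section Operator
variable {ι γ V : Type*} [Fintype ι] [Fintype γ] [NormedAddCommGroup V] [InnerProductSpace ℂ V]

/-- The linear combination with coefficients `v` of the columns `∑ₐ y(a, j) pₐ`. -/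
noncomputable def columnComb (p : ι → V) (y : ι × γ → ℂ) (v : EuclideanSpace ℂ γ) : V :=
  ∑ j, v j • ∑ a, y (a, j) • p a

lemma columnComb_sub (p : ι → V) (y : ι × γ → ℂ) (v w : EuclideanSpace ℂ γ) :
    columnComb p y (v - w) = columnComb p y v - columnComb p y w := by
  simp [columnComb, sub_smul]

lemma columnComb_smul (p : ι → V) (y : ι × γ → ℂ) (c : ℂ) (v : EuclideanSpace ℂ γ) :
    columnComb p y (c • v) = c • columnComb p y v := by
  simp [columnComb, Finset.smul_sum, mul_smul]

lemma continuous_columnComb (p : ι → V) :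
    Continuous fun q : (ι × γ → ℂ) × EuclideanSpace ℂ γ => columnComb p q.1 q.2 := by
  unfold columnComb
  fun_prop

lemma columnComb_le_mul {p : ι → V} {y : ι × γ → ℂ} {T : ℝ}
    (h : ∀ v : EuclideanSpace ℂ γ, ‖v‖ ≤ 1 → ‖columnComb p y v‖ ≤ T)
    (v : EuclideanSpace ℂ γ) : ‖columnComb p y v‖ ≤ T * ‖v‖ := by
  rcases eq_or_ne v 0 with rfl | hv
  · simp [columnComb]
  · have hv' : 0 < ‖v‖ := norm_pos_iff.2 hv
    have h1 := h (((‖v‖⁻¹ : ℝ) : ℂ) • v) (by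
      rw [norm_smul, Complex.norm_real, norm_inv, norm_norm, inv_mul_cancel₀ hv'.ne'])
    rw [columnComb_smul, norm_smul, Complex.norm_real, norm_inv, norm_norm] at h1
    rwa [inv_mul_le_iff₀ hv', mul_comm] at h1

lemma IsParsevalFrame.lintegral_eexp_inner_columnComb_le {p : ι → V} (hp : IsParsevalFrame p)
    {κ : ℝ} {μ : Measure ℂ} [IsProbabilityMeasure μ] (hμ : SubgaussianLaw κ μ)
    (v : EuclideanSpace ℂ γ) (u : V) :
    ∫⁻ y, eexp (inner ℂ (columnComb p y v) u).re ∂(Measure.pi fun _ : ι × γ => μ) ≤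
      eexp (κ * (‖v‖ ^ 2 * ‖u‖ ^ 2)) := by
  have e : ∀ y : ι × γ → ℂ, (inner ℂ (columnComb p y v) u).re =
      ∑ q : ι × γ, ((v q.2 * inner ℂ u (p q.1)) * y q).re := by
    intro y
    rw [← Complex.re_sum, ← inner_conj_symm, Complex.conj_re, Fintype.sum_prod_type_right,
      columnComb, inner_sum]
    congr 1
    refine Finset.sum_congr rfl fun j _ => ?_
    rw [inner_smul_right, inner_sum, Finset.mul_sum]
    refine Finset.sum_congr rfl fun a _ => ?_
    rw [inner_smul_right]; ring
  simp_rw [e]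
  refine (lintegral_eexp_linear_le hμ _).trans (eexp_mono (le_of_eq ?_))
  rw [Fintype.sum_prod_type_right, EuclideanSpace.norm_sq_eq, Finset.sum_mul]
  congr 1
  refine Finset.sum_congr rfl fun j _ => ?_
  rw [← hp u, Finset.mul_sum]
  exact Finset.sum_congr rfl fun a _ => by rw [norm_mul, mul_pow]

lemma IsParsevalFrame.lintegral_eexp_columnComb_sq_le [FiniteDimensional ℂ V] {p : ι → V}
    (hp : IsParsevalFrame p) {κ : ℝ} (hκ : 0 < κ) {μ : Measure ℂ} [IsProbabilityMeasure μ]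
    (hμ : SubgaussianLaw κ μ) {v : EuclideanSpace ℂ γ} (hv : ‖v‖ ≤ 2) :
    ∫⁻ y, eexp (‖columnComb p y v‖ ^ 2 / (32 * κ)) ∂(Measure.pi fun _ : ι × γ => μ) ≤
      eexp (Module.finrank ℂ V) := by
  borelize V
  have hm : Measurable fun y : ι × γ → ℂ => columnComb p y v :=
    ((continuous_columnComb p).comp (Continuous.prodMk_left v)).measurable
  have h := lintegral_eexp_sq_norm_le (Measure.pi fun _ : ι × γ => μ)
    (fun y => columnComb p y v) hm (4 * κ) (by positivity) fun u =>
      (hp.lintegral_eexp_inner_columnComb_le hμ v u).trans (eexp_mono ?_)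
  · refine le_trans (le_of_eq ?_) (h.trans (two_pow_le_eexp _))
    congr 1; ext y; congr 2; ring
  · have : ‖v‖ ^ 2 ≤ 4 := by nlinarith [norm_nonneg v]
    calc κ * (‖v‖ ^ 2 * ‖u‖ ^ 2) ≤ κ * (4 * ‖u‖ ^ 2) := by gcongr
      _ = _ := by ring

/-- Operator norm bound. If the supremum of `‖columnComb p y v‖` over unit vectors is `T`, then
this quantity is at least `T / 2` on a ball of radius `1 / 2` around a maximizer; comparing the
volume of that ball with that of the ball of radius `2`, on which exponential moments are under
control, takes the place of a net argument. -/
lemma IsParsevalFrame.measure_exists_columnComb_le [FiniteDimensional ℂ V] {p : ι → V}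
    (hp : IsParsevalFrame p) {κ : ℝ} (hκ : 0 < κ) {μ : Measure ℂ} [IsProbabilityMeasure μ]
    (hμ : SubgaussianLaw κ μ) (hγ : Fintype.card γ ≤ Module.finrank ℂ V) :
    (Measure.pi fun _ : ι × γ => μ) {y | ∃ v : EuclideanSpace ℂ γ, ‖v‖ ≤ 1 ∧
      768 * κ * Module.finrank ℂ V < ‖columnComb p y v‖ ^ 2} ≤ eexp (-(Module.finrank ℂ V)) := by
  set d : ℝ := (Module.finrank ℂ V : ℝ)
  have hd : 0 ≤ d := Nat.cast_nonneg _
  have : FiniteDimensional ℝ (EuclideanSpace ℂ γ) := FiniteDimensional.complexToReal _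
  obtain ⟨ν, hν⟩ : ∃ ν : Measure (EuclideanSpace ℂ γ), ν.IsAddHaarMeasure :=
    ⟨Measure.addHaar, inferInstance⟩
  set F : (ι × γ → ℂ) → ENNReal := fun y =>
    ∫⁻ v in Metric.ball (0 : EuclideanSpace ℂ γ) 2, eexp (‖columnComb p y v‖ ^ 2 / (32 * κ)) ∂ν
  have hm : Measurable fun q : (ι × γ → ℂ) × EuclideanSpace ℂ γ =>
      eexp (‖columnComb p q.1 q.2‖ ^ 2 / (32 * κ)) := by
    refine Measurable.eexp (Continuous.measurable ?_)
    exact ((continuous_columnComb p).norm.pow 2).div_const _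
  have hmy : ∀ y : ι × γ → ℂ, Measurable fun v : EuclideanSpace ℂ γ =>
      eexp (‖columnComb p y v‖ ^ 2 / (32 * κ)) := by
    intro y
    refine Measurable.eexp (Continuous.measurable ?_)
    exact (((continuous_columnComb p).comp (Continuous.prodMk_right y)).norm.pow 2).div_const _
  have hFm : Measurable F := hm.lintegral_prod_right'
  set b : ENNReal := ν (Metric.ball (0 : EuclideanSpace ℂ γ) (1 / 2))
  have hb0 : b ≠ 0 := (Metric.measure_ball_pos ν _ (by norm_num)).ne'
  have hbt : b ≠ ⊤ := measure_ball_lt_top.ne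
  have h2 : ν (Metric.ball (0 : EuclideanSpace ℂ γ) 2) ≤ eexp (4 * d) * b := by
    have h := Measure.addHaar_ball_mul_of_pos ν (0 : EuclideanSpace ℂ γ)
      (show (0 : ℝ) < 4 by norm_num) (1 / 2)
    have e2 : (4 : ℝ) * (1 / 2) = 2 := by norm_num
    rw [e2] at h
    rw [h]
    refine mul_le_mul_left (ENNReal.ofReal_le_ofReal ?_) _
    have hE : Module.finrank ℝ (EuclideanSpace ℂ γ) = 2 * Fintype.card γ := by
      rw [finrank_real_of_complex, finrank_euclideanSpace]
    have h4 : (2 : ℝ) ≤ Real.exp 1 := by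
      have := Real.add_one_le_exp (1 : ℝ); linarith
    rw [hE]
    calc (4 : ℝ) ^ (2 * Fintype.card γ) = 2 ^ (4 * Fintype.card γ) := by
          rw [show (4 : ℝ) = 2 ^ 2 by norm_num, ← pow_mul]; congr 1; ring
      _ ≤ 2 ^ (4 * Module.finrank ℂ V) := by gcongr; norm_num
      _ ≤ Real.exp 1 ^ (4 * Module.finrank ℂ V) := by gcongr
      _ = Real.exp (4 * d) := by rw [← Real.exp_nat_mul]; simp [d]
  have hF : ∫⁻ y, F y ∂(Measure.pi fun _ : ι × γ => μ) ≤ eexp d * (eexp (4 * d) * b) := by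
    calc _ = ∫⁻ v in Metric.ball (0 : EuclideanSpace ℂ γ) 2, ∫⁻ y,
            eexp (‖columnComb p y v‖ ^ 2 / (32 * κ))
            ∂(Measure.pi fun _ : ι × γ => μ) ∂ν := lintegral_lintegral_swap hm.aemeasurable
      _ ≤ ∫⁻ v in Metric.ball (0 : EuclideanSpace ℂ γ) 2, eexp d ∂ν := by
          refine setLIntegral_mono measurable_const fun v hv => ?_
          exact hp.lintegral_eexp_columnComb_sq_le hκ hμ (mem_ball_zero_iff.1 hv).le
      _ ≤ _ := by rw [setLIntegral_const]; gcongr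
  have hsub : {y : ι × γ → ℂ | ∃ v : EuclideanSpace ℂ γ, ‖v‖ ≤ 1 ∧
      768 * κ * d < ‖columnComb p y v‖ ^ 2} ⊆
      {y | eexp (6 * d) * b ≤ F y} := by
    rintro y ⟨v, hv, hvy⟩
    obtain ⟨v₀, hv₀, hmax⟩ := (isCompact_closedBall (0 : EuclideanSpace ℂ γ) 1).exists_isMaxOn
      ⟨0, by simp⟩ (f := fun v => ‖columnComb p y v‖)
      ((continuous_columnComb p).comp (Continuous.prodMk_right y)).norm.continuousOn
    set T := ‖columnComb p y v₀‖
    have hT : ∀ w : EuclideanSpace ℂ γ, ‖w‖ ≤ 1 → ‖columnComb p y w‖ ≤ T := fun w hw =>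
      hmax (mem_closedBall_zero_iff.2 hw)
    have hv₀' : ‖v₀‖ ≤ 1 := mem_closedBall_zero_iff.1 hv₀
    have hT2 : 768 * κ * d ≤ T ^ 2 := hvy.le.trans (by gcongr; exact hT v hv)
    have hball : Metric.ball v₀ (1 / 2) ⊆ Metric.ball (0 : EuclideanSpace ℂ γ) 2 := by
      refine Metric.ball_subset_ball' ?_
      rw [dist_zero_right]; linarith
    calc eexp (6 * d) * b = ∫⁻ _ in Metric.ball v₀ (1 / 2), eexp (6 * d) ∂ν := by
          rw [setLIntegral_const, Measure.addHaar_ball_center]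
      _ ≤ ∫⁻ v in Metric.ball v₀ (1 / 2), eexp (‖columnComb p y v‖ ^ 2 / (32 * κ)) ∂ν := by
          refine setLIntegral_mono (hmy y) fun w hw => ?_
          refine eexp_mono ?_
          have hw' : ‖w - v₀‖ ≤ 1 / 2 := (mem_ball_iff_norm.1 hw).le
          have h6 := columnComb_le_mul hT (w - v₀)
          rw [columnComb_sub] at h6
          have h7 : T / 2 ≤ ‖columnComb p y w‖ := by
            have h8 := norm_sub_norm_le (columnComb p y v₀) (columnComb p y w)
            rw [norm_sub_rev] at h8
            have h9 : T * ‖w - v₀‖ ≤ T * (1 / 2) := by gcongr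
            change T - _ ≤ _ at h8
            linarith
          rw [le_div_iff₀ (by positivity)]
          have : (T / 2) ^ 2 ≤ ‖columnComb p y w‖ ^ 2 := by gcongr
          nlinarith
      _ ≤ F y := lintegral_mono_set hball
  have hmk := mul_meas_ge_le_lintegral (μ := Measure.pi fun _ : ι × γ => μ) hFm (eexp (6 * d) * b)
  have hc0 : eexp (6 * d) * b ≠ 0 := mul_ne_zero (eexp_ne_zero _) hb0
  have hct : eexp (6 * d) * b ≠ ⊤ := ENNReal.mul_ne_top (eexp_ne_top _) hbt
  refine (ENNReal.mul_le_mul_iff_right hc0 hct).1 ?_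
  refine (mul_le_mul_right (measure_mono hsub) _).trans (hmk.trans (hF.trans (le_of_eq ?_)))
  rw [mul_right_comm, ← mul_assoc, ← eexp_add, ← eexp_add]
  congr 2; ring

end Operator

/-! ### Consequences of normalization and Gaussian tails -/

lemma exp_le_add_exp_sq (y : ℝ) : Real.exp y ≤ y + Real.exp (y ^ 2) := by
  have h2 := Real.add_one_le_exp (y ^ 2)
  rcases le_total |y| 1 with h | h
  · have := (abs_le.1 (Real.abs_exp_sub_one_sub_id_le h)).2
    linarith
  · rcases le_abs.1 h with h | h
    · have : Real.exp y ≤ Real.exp (y ^ 2) := Real.exp_le_exp.2 (by nlinarith)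
      linarith
    · have : Real.exp y ≤ 1 := Real.exp_le_one_iff.2 (by linarith)
      nlinarith

lemma exp_neg_le_quadratic {x : ℝ} (hx : 0 ≤ x) : Real.exp (-x) ≤ 1 - x + x ^ 2 := by
  rcases le_total x 1 with h | h
  · have := (abs_le.1 (Real.abs_exp_sub_one_sub_id_le (x := -x)
      (by rwa [abs_neg, abs_of_nonneg hx]))).2
    linarith
  · have : Real.exp (-x) ≤ 1 := Real.exp_le_one_iff.2 (by linarith)
    nlinarith

section Moments
variable {μ : Measure ℂ}

/-- Gaussian tails give an exponential moment of the square of the modulus. -/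
lemma lintegral_eexp_sq_le_of_tail [IsProbabilityMeasure μ] {K₀ c₀ : ℝ}
    (hK₀ : 0 < K₀) (hc₀ : 0 ≤ c₀)
    (h : ∀ t : ℝ, 0 ≤ t → μ.real {z | t ≤ ‖z‖} ≤ c₀ * Real.exp (-t ^ 2 / K₀)) :
    ∫⁻ z, eexp (‖z‖ ^ 2 / (2 * K₀)) ∂μ ≤ ENNReal.ofReal (1 + c₀) := by
  set θ := 1 / (2 * K₀) with hθ
  have hθ0 : 0 < θ := by positivity
  have hint : ∀ x : ℝ, ∫ t in (0 : ℝ)..x, θ * Real.exp (θ * t) = Real.exp (θ * x) - 1 := by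
    intro x
    rw [intervalIntegral.integral_const_mul, intervalIntegral.mul_integral_comp_mul_left]
    simp
  have hlc := lintegral_comp_eq_lintegral_meas_le_mul μ (f := fun z : ℂ => ‖z‖ ^ 2)
    (g := fun t => θ * Real.exp (θ * t)) (Filter.Eventually.of_forall fun z => by positivity)
    (by fun_prop) (fun t _ =>
      (by fun_prop : Continuous fun t => θ * Real.exp (θ * t)).intervalIntegrable _ _)
    (Filter.Eventually.of_forall fun t => by positivity)
  simp_rw [hint] at hlc
  have hexp : ∫⁻ t in Set.Ioi (0 : ℝ), ENNReal.ofReal (c₀ * (θ * Real.exp (-θ * t))) =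
      ENNReal.ofReal c₀ := by
    have hi : IntegrableOn (fun t => Real.exp (-θ * t)) (Set.Ioi 0) :=
      integrableOn_exp_mul_Ioi (by linarith) 0
    rw [← ofReal_integral_eq_lintegral_ofReal ((hi.const_mul θ).const_mul c₀)
      (Filter.Eventually.of_forall fun t => by positivity), integral_const_mul, integral_const_mul,
      integral_exp_mul_Ioi (by linarith)]
    congr 1; field_simp; simp
  have hle : ∫⁻ z, ENNReal.ofReal (Real.exp (θ * ‖z‖ ^ 2) - 1) ∂μ ≤ ENNReal.ofReal c₀ := by
    rw [hlc, ← hexp]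
    refine setLIntegral_mono (by fun_prop) fun t ht => ?_
    have ht0 : 0 ≤ t := le_of_lt ht
    have hs : {z : ℂ | t ≤ ‖z‖ ^ 2} = {z : ℂ | √t ≤ ‖z‖} := by
      ext z; exact (Real.sqrt_le_left (norm_nonneg z)).symm
    rw [hs, ← ofReal_measureReal, ← ENNReal.ofReal_mul measureReal_nonneg]
    refine ENNReal.ofReal_le_ofReal ?_
    calc _ ≤ c₀ * Real.exp (-√t ^ 2 / K₀) * (θ * Real.exp (θ * t)) := by
          gcongr; exact h _ (Real.sqrt_nonneg t)
      _ = c₀ * (θ * (Real.exp (-√t ^ 2 / K₀) * Real.exp (θ * t))) := by ring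
      _ = _ := by
          rw [← Real.exp_add, Real.sq_sqrt ht0]
          congr 3; rw [hθ]; field_simp; ring
  calc ∫⁻ z, eexp (‖z‖ ^ 2 / (2 * K₀)) ∂μ
      ≤ ∫⁻ z, (1 + ENNReal.ofReal (Real.exp (θ * ‖z‖ ^ 2) - 1)) ∂μ := by
        refine lintegral_mono fun z => ?_
        rw [← ENNReal.ofReal_one, ← ENNReal.ofReal_add zero_le_one (by
          have := Real.one_le_exp (show 0 ≤ θ * ‖z‖ ^ 2 by positivity); linarith)]
        refine ENNReal.ofReal_le_ofReal (le_of_eq ?_)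
        rw [add_sub_cancel]; congr 1; rw [hθ]; ring
    _ ≤ _ := by
        rw [lintegral_add_left measurable_const, ENNReal.ofReal_add zero_le_one hc₀]
        simpa using hle

lemma integrable_exp_of_lintegral_le {f : ℂ → ℝ} (hf : Measurable f) {B : ℝ}
    (h : ∫⁻ z, eexp (f z) ∂μ ≤ ENNReal.ofReal B) : Integrable (fun z => Real.exp (f z)) μ := by
  refine ⟨by fun_prop, ?_⟩
  rw [hasFiniteIntegral_iff_ofReal (Filter.Eventually.of_forall fun z => (Real.exp_pos _).le)]
  exact h.trans_lt ENNReal.ofReal_lt_top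

/-- A centered random variable with a finite exponential moment of `θ |z|²` is subgaussian. -/
lemma subgaussianLaw_of_tail [IsProbabilityMeasure μ] {θ c₀ : ℝ} (hθ : 0 < θ) (hc₀ : 0 ≤ c₀)
    (h : ∫⁻ z, eexp (θ * ‖z‖ ^ 2) ∂μ ≤ ENNReal.ofReal (1 + c₀))
    (hi : Integrable (fun z : ℂ => z) μ) (h0 : ∫ z, z ∂μ = 0) :
    SubgaussianLaw ((1 + c₀) / θ) μ := by
  have hA : ∫⁻ z, eexp (θ * ‖z‖ ^ 2) ∂μ ≤ eexp c₀ := h.trans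
    (ENNReal.ofReal_le_ofReal (by linarith [Real.add_one_le_exp c₀]))
  intro a
  have hre : ∀ z : ℂ, |(a * z).re| ≤ ‖a‖ * ‖z‖ := fun z =>
    (Complex.abs_re_le_norm _).trans_eq (norm_mul _ _)
  -- For small `a` the mean zero condition removes the linear term; for large `a` it is not needed,
  -- since `|a| |z| ≤ |a|² / θ + θ |z|²`.
  rcases le_total (‖a‖ ^ 2) θ with ha | ha
  · have h1 : ∫⁻ z, eexp ((a * z).re ^ 2) ∂μ ≤ eexp (‖a‖ ^ 2 / θ * c₀) := by
      refine le_trans (lintegral_mono fun z => eexp_mono ?_)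
        (lintegral_eexp_mul_le (by positivity) ((div_le_one hθ).2 ha) hA)
      rw [← sq_abs]
      calc |(a * z).re| ^ 2 ≤ (‖a‖ * ‖z‖) ^ 2 := by gcongr; exact hre z
        _ = _ := by field_simp
    have hint1 : Integrable (fun z => Real.exp ((a * z).re ^ 2)) μ :=
      integrable_exp_of_lintegral_le (by fun_prop) h1
    have hint2 : Integrable (fun z => (a * z).re) μ := (hi.const_mul a).re
    have h2 : ∫ z, (a * z).re ∂μ = 0 := by
      have := integral_re (hi.const_mul a)
      simp only [RCLike.re_eq_complex_re] at this
      rw [this, integral_const_mul, h0]; simp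
    calc ∫⁻ z, eexp (a * z).re ∂μ
        ≤ ∫⁻ z, ENNReal.ofReal ((a * z).re + Real.exp ((a * z).re ^ 2)) ∂μ :=
          lintegral_mono fun z => ENNReal.ofReal_le_ofReal (exp_le_add_exp_sq _)
      _ = ENNReal.ofReal (∫ z, Real.exp ((a * z).re ^ 2) ∂μ) := by
          have hint3 : Integrable (fun z => (a * z).re + Real.exp ((a * z).re ^ 2)) μ :=
            hint2.add hint1
          rw [← ofReal_integral_eq_lintegral_ofReal hint3
            (Filter.Eventually.of_forall fun z =>
              (Real.exp_pos _).le.trans (exp_le_add_exp_sq (a * z).re)),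
            integral_add hint2 hint1, h2, zero_add]
      _ = ∫⁻ z, eexp ((a * z).re ^ 2) ∂μ :=
          ofReal_integral_eq_lintegral_ofReal hint1
            (Filter.Eventually.of_forall fun z => (Real.exp_pos _).le)
      _ ≤ eexp (‖a‖ ^ 2 / θ * c₀) := h1
      _ ≤ _ := by
          refine eexp_mono ?_
          have : 0 ≤ ‖a‖ ^ 2 / θ := by positivity
          calc ‖a‖ ^ 2 / θ * c₀ ≤ ‖a‖ ^ 2 / θ * (1 + c₀) := by gcongr; linarith
            _ = _ := by ring
  · calc ∫⁻ z, eexp (a * z).re ∂μ ≤ ∫⁻ z, eexp (‖a‖ ^ 2 / θ) * eexp (θ * ‖z‖ ^ 2) ∂μ := by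
          refine lintegral_mono fun z => ?_
          rw [← eexp_add]
          refine eexp_mono (((le_abs_self _).trans (hre z)).trans ?_)
          rw [div_add' _ _ _ hθ.ne', le_div_iff₀ hθ]
          nlinarith [sq_nonneg (‖a‖ - θ * ‖z‖), sq_nonneg (‖a‖), sq_nonneg (θ * ‖z‖)]
      _ ≤ eexp (‖a‖ ^ 2 / θ) * eexp c₀ := by
          rw [lintegral_const_mul' _ _ (eexp_ne_top _)]; gcongr
      _ ≤ _ := by
          rw [← eexp_add]
          refine eexp_mono ?_
          have : 1 ≤ ‖a‖ ^ 2 / θ := (one_le_div hθ).2 ha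
          calc ‖a‖ ^ 2 / θ + c₀ ≤ ‖a‖ ^ 2 / θ + (‖a‖ ^ 2 / θ) * c₀ := by nlinarith
            _ = _ := by ring

/-- The fourth moment controls the second order term of the Laplace transform of `|z|²`. -/
lemma sqNormLaplaceBound_of_tail [IsProbabilityMeasure μ] {θ c₀ : ℝ} (hθ : 0 < θ) (hc₀ : 0 ≤ c₀)
    (h : ∫⁻ z, eexp (θ * ‖z‖ ^ 2) ∂μ ≤ ENNReal.ofReal (1 + c₀))
    (h1 : ∫ z, ‖z‖ ^ 2 ∂μ = 1) :
    SqNormLaplaceBound (2 * (1 + c₀) / θ ^ 2) μ := by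
  have hE : Integrable (fun z : ℂ => Real.exp (θ * ‖z‖ ^ 2)) μ :=
    integrable_exp_of_lintegral_le (by fun_prop) h
  have hEle : ∫ z, Real.exp (θ * ‖z‖ ^ 2) ∂μ ≤ 1 + c₀ := by
    refine (ENNReal.ofReal_le_ofReal_iff (by linarith)).1 ?_
    rw [ofReal_integral_eq_lintegral_ofReal hE
      (Filter.Eventually.of_forall fun z => (Real.exp_pos _).le)]
    exact h
  have hi1 : Integrable (fun z : ℂ => ‖z‖ ^ 2) μ := by
    by_contra hn
    rw [integral_undef hn] at h1
    exact zero_ne_one h1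
  have hb : ∀ z : ℂ, (‖z‖ ^ 2) ^ 2 ≤ 2 / θ ^ 2 * Real.exp (θ * ‖z‖ ^ 2) := by
    intro z
    have := Real.quadratic_le_exp_of_nonneg (show 0 ≤ θ * ‖z‖ ^ 2 by positivity)
    rw [div_mul_eq_mul_div, le_div_iff₀ (by positivity)]
    nlinarith [show 0 ≤ θ * ‖z‖ ^ 2 by positivity]
  have hi2 : Integrable (fun z : ℂ => (‖z‖ ^ 2) ^ 2) μ :=
    (hE.const_mul (2 / θ ^ 2)).mono' (by fun_prop) (Filter.Eventually.of_forall fun z => by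
      rw [Real.norm_of_nonneg (by positivity)]; exact hb z)
  have h2 : ∫ z, (‖z‖ ^ 2) ^ 2 ∂μ ≤ 2 * (1 + c₀) / θ ^ 2 := by
    calc _ ≤ ∫ z, 2 / θ ^ 2 * Real.exp (θ * ‖z‖ ^ 2) ∂μ :=
          integral_mono hi2 (hE.const_mul _) hb
      _ ≤ 2 / θ ^ 2 * (1 + c₀) := by rw [integral_const_mul]; gcongr
      _ = _ := by ring
  intro s hs
  have hi3 : Integrable (fun z : ℂ => 1 - s * ‖z‖ ^ 2 + s ^ 2 * (‖z‖ ^ 2) ^ 2) μ :=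
    ((integrable_const 1).sub (hi1.const_mul s)).add (hi2.const_mul _)
  have hq : ∀ z : ℂ, Real.exp (-(s * ‖z‖ ^ 2)) ≤ 1 - s * ‖z‖ ^ 2 + s ^ 2 * (‖z‖ ^ 2) ^ 2 :=
    fun z => (exp_neg_le_quadratic (by positivity)).trans_eq (by ring)
  calc ∫⁻ z, eexp (-(s * ‖z‖ ^ 2)) ∂μ
      ≤ ∫⁻ z, ENNReal.ofReal (1 - s * ‖z‖ ^ 2 + s ^ 2 * (‖z‖ ^ 2) ^ 2) ∂μ :=
        lintegral_mono fun z => ENNReal.ofReal_le_ofReal (hq z)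
    _ = ENNReal.ofReal (1 - s + s ^ 2 * ∫ z, (‖z‖ ^ 2) ^ 2 ∂μ) := by
        have hi4 : Integrable (fun z : ℂ => 1 - s * ‖z‖ ^ 2) μ :=
          (integrable_const 1).sub (hi1.const_mul s)
        rw [← ofReal_integral_eq_lintegral_ofReal hi3
          (Filter.Eventually.of_forall fun z => (Real.exp_pos _).le.trans (hq z)),
          integral_add hi4 (hi2.const_mul _),
          integral_sub (integrable_const 1) (hi1.const_mul s), integral_const_mul,
          integral_const_mul, h1]
        simp
    _ ≤ _ := by
        refine ENNReal.ofReal_le_ofReal (le_trans ?_ (Real.add_one_le_exp _))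
        nlinarith [mul_le_mul_of_nonneg_left h2 (sq_nonneg s)]

end Moments

section Normalized
variable {Ω : Type*} [MeasurableSpace Ω] {P : Measure Ω}

lemma IsRealNormalized.memLp [IsProbabilityMeasure P] {η : Ω → ℝ} (h : IsRealNormalized η P) :
    MemLp η 2 P := by
  by_contra hn
  have := variance_of_not_memLp h.1.aestronglyMeasurable hn
  rw [h.2.2] at this
  exact one_ne_zero this

lemma IsRealNormalized.integral_sq {η : Ω → ℝ} (h : IsRealNormalized η P) :
    ∫ ω, η ω ^ 2 ∂P = 1 := by
  rw [← variance_of_integral_eq_zero h.1 h.2.1, h.2.2]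

/-- Normalized random variables, real or complex, are centered and of unit second absolute
moment. -/
lemma IsNormalized.moments [IsProbabilityMeasure P] {ξ : Ω → ℂ} (h : IsNormalized ξ P) :
    AEMeasurable ξ P ∧ Integrable ξ P ∧ ∫ ω, ξ ω ∂P = 0 ∧ ∫ ω, ‖ξ ω‖ ^ 2 ∂P = 1 := by
  rcases h with ⟨η, hη, he⟩ | ⟨ξ₁, ξ₂, h1, -, hid, he⟩
  · have hi : Integrable η P := hη.memLp.integrable (by norm_num)
    have hi' : Integrable (fun ω => (η ω : ℂ)) P := hi.ofReal
    have he' : ξ =ᵐ[P] fun ω => (η ω : ℂ) := he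
    refine ⟨hi'.aestronglyMeasurable.aemeasurable.congr he'.symm, hi'.congr he'.symm, ?_, ?_⟩
    · rw [integral_congr_ae he', integral_complex_ofReal, hη.2.1]; simp
    · rw [← hη.integral_sq]
      refine integral_congr_ae ?_
      filter_upwards [he'] with ω hω
      rw [hω, Complex.norm_real, Real.norm_eq_abs, sq_abs]
  · have hm1 := h1.memLp
    have hm2 : MemLp ξ₂ 2 P := (hid.memLp_iff).1 hm1
    have hi1 : Integrable ξ₁ P := hm1.integrable (by norm_num)
    have hi2 : Integrable ξ₂ P := hm2.integrable (by norm_num)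
    have h02 : ∫ ω, ξ₂ ω ∂P = 0 := hid.integral_eq.symm.trans h1.2.1
    have hs2 : ∫ ω, ξ₂ ω ^ 2 ∂P = 1 :=
      (hid.comp (u := fun x : ℝ => x ^ 2) (by fun_prop)).integral_eq.symm.trans h1.integral_sq
    have hi1' : Integrable (fun ω => (ξ₁ ω : ℂ)) P := hi1.ofReal
    have hi2' : Integrable (fun ω => Complex.I * (ξ₂ ω : ℂ)) P := hi2.ofReal.const_mul _
    have hi12 : Integrable (fun ω => (ξ₁ ω : ℂ) + Complex.I * (ξ₂ ω : ℂ)) P :=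
      hi1'.add hi2'
    have hi : Integrable
        (fun ω => ((ξ₁ ω : ℂ) + Complex.I * (ξ₂ ω : ℂ)) / (Real.sqrt 2 : ℂ)) P :=
      hi12.div_const _
    have he' : ξ =ᵐ[P]
      fun ω => ((ξ₁ ω : ℂ) + Complex.I * (ξ₂ ω : ℂ)) / (Real.sqrt 2 : ℂ) := he
    refine ⟨hi.aestronglyMeasurable.aemeasurable.congr he'.symm, hi.congr he'.symm, ?_, ?_⟩
    · rw [integral_congr_ae he', integral_div, integral_add hi1' hi2', integral_const_mul,
        integral_complex_ofReal, integral_complex_ofReal, h1.2.1, h02]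
      simp
    · have e : ∫ ω, ‖ξ ω‖ ^ 2 ∂P = ∫ ω, (ξ₁ ω ^ 2 + ξ₂ ω ^ 2) / 2 ∂P := by
        refine integral_congr_ae ?_
        filter_upwards [he'] with ω hω
        rw [hω, norm_div, div_pow, Complex.norm_real, Real.norm_eq_abs, sq_abs,
          Real.sq_sqrt (by norm_num), ← Complex.normSq_eq_norm_sq, mul_comm Complex.I,
          Complex.normSq_add_mul_I]
      rw [e, integral_div, integral_add hm1.integrable_sq hm2.integrable_sq, h1.integral_sq, hs2]
      norm_num

lemma IsNormalized.laws [IsProbabilityMeasure P] {ξ : Ω → ℂ}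
    (h : IsNormalized ξ P) {K₀ c₀ : ℝ} (hK₀ : 0 < K₀)
    (hc₀ : 0 ≤ c₀) (ht : IsSubgaussianWith K₀ c₀ ξ P) :
    SubgaussianLaw (2 * K₀ * (1 + c₀)) (P.map ξ) ∧
      SqNormLaplaceBound (8 * K₀ ^ 2 * (1 + c₀)) (P.map ξ) := by
  obtain ⟨hm, hi, h0, h1⟩ := h.moments
  have := Measure.isProbabilityMeasure_map hm
  have htail : ∀ t : ℝ, 0 ≤ t →
      (P.map ξ).real {z | t ≤ ‖z‖} ≤ c₀ * Real.exp (-t ^ 2 / K₀) := by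
    intro t ht0
    have hset : MeasurableSet {z : ℂ | t ≤ ‖z‖} := measurableSet_le (by fun_prop) (by fun_prop)
    rw [measureReal_def, Measure.map_apply_of_aemeasurable hm hset]
    exact ht t ht0
  have hexp : ∫⁻ z, eexp (1 / (2 * K₀) * ‖z‖ ^ 2) ∂(P.map ξ) ≤ ENNReal.ofReal (1 + c₀) := by
    refine le_trans (le_of_eq ?_) (lintegral_eexp_sq_le_of_tail hK₀ hc₀ htail)
    congr 1; ext z; congr 1; ring
  have hθ : 0 < 1 / (2 * K₀) := by positivity
  constructor
  · have := subgaussianLaw_of_tail hθ hc₀ hexp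
      ((integrable_map_measure (g := fun z : ℂ => z) (by fun_prop) hm).2 hi)
      (by rw [integral_map hm (by fun_prop)]; exact h0)
    convert this using 1
    field_simp
  · have := sqNormLaplaceBound_of_tail hθ hc₀ hexp
      (by rw [integral_map hm (by fun_prop)]; exact h1)
    convert this using 1
    field_simp
    norm_num

end Normalized

/-! ### Approximate eigenvectors concentrated at a coordinate -/

section Event
variable {ι : Type*} [Fintype ι]

/-- The projections of the standard basis vectors to a subspace form a Parseval frame. -/
lemma isParsevalFrame_projection [DecidableEq ι] (V : Submodule ℂ (EuclideanSpace ℂ ι)) :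
    IsParsevalFrame fun a => V.orthogonalProjectionOnto (EuclideanSpace.single a 1) := by
  intro v
  simp_rw [Submodule.inner_orthogonalProjectionOnto_eq_of_mem_left]
  rw [← Submodule.norm_coe, EuclideanSpace.norm_sq_eq]
  refine Finset.sum_congr rfl fun a _ => ?_
  rw [EuclideanSpace.inner_single_right, one_mul, RCLike.norm_conj]

/-- The matrices `y`, indexed by pairs (row, column), that have an `ε`-approximate unit eigenvector
`x` for the eigenvalue `z` with `|xᵢ| ≥ t` and `‖x_J‖ ≤ c |xᵢ|`. All inequalities are non-strict, so
that this set is closed. -/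
def approxEigenSet (z : ℂ) (i : ι) (J : Finset ι) (c t ε : ℝ) : Set (ι × ι → ℂ) :=
  {y | ∃ x : EuclideanSpace ℂ ι, ‖x‖ = 1 ∧ t ≤ ‖x i‖ ∧ ∑ j ∈ J, ‖x j‖ ^ 2 ≤ c ^ 2 * ‖x i‖ ^ 2 ∧
    ‖WithLp.toLp 2 (fun a => ∑ j, y (a, j) * x j) - z • x‖ ≤ ε}

/-- The set is the projection of a closed set along the compact unit sphere. In particular it is
measurable, which is needed for conditioning on the columns outside `{i} ∪ J`. -/
lemma isClosed_approxEigenSet (z : ℂ) (i : ι) (J : Finset ι) (c t ε : ℝ) :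
    IsClosed (approxEigenSet z i J c t ε) := by
  let S : Set ((ι × ι → ℂ) × Metric.sphere (0 : EuclideanSpace ℂ ι) 1) :=
    {q | t ≤ ‖q.2.1 i‖ ∧ ∑ j ∈ J, ‖q.2.1 j‖ ^ 2 ≤ c ^ 2 * ‖q.2.1 i‖ ^ 2 ∧
      ‖WithLp.toLp 2 (fun a => ∑ j, q.1 (a, j) * q.2.1 j) - z • q.2.1‖ ≤ ε}
  have hS : IsClosed S := by
    have h1 : IsClosed {q : (ι × ι → ℂ) × Metric.sphere (0 : EuclideanSpace ℂ ι) 1 |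
        t ≤ ‖q.2.1 i‖} := isClosed_le (by fun_prop) (by fun_prop)
    have h2 : IsClosed {q : (ι × ι → ℂ) × Metric.sphere (0 : EuclideanSpace ℂ ι) 1 |
        ∑ j ∈ J, ‖q.2.1 j‖ ^ 2 ≤ c ^ 2 * ‖q.2.1 i‖ ^ 2} := isClosed_le (by fun_prop) (by fun_prop)
    have h3 : IsClosed {q : (ι × ι → ℂ) × Metric.sphere (0 : EuclideanSpace ℂ ι) 1 |
        ‖WithLp.toLp 2 (fun a => ∑ j, q.1 (a, j) * q.2.1 j) - z • q.2.1‖ ≤ ε} :=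
      isClosed_le (by fun_prop) (by fun_prop)
    exact h1.inter (h2.inter h3)
  have e : approxEigenSet z i J c t ε = Prod.fst '' S := by
    ext y
    constructor
    · rintro ⟨x, hx, h1, h2, h3⟩
      exact ⟨(y, ⟨x, by simpa using hx⟩), ⟨h1, h2, h3⟩, rfl⟩
    · rintro ⟨⟨y', ⟨x, hx⟩⟩, ⟨h1, h2, h3⟩, rfl⟩
      exact ⟨x, by simpa using hx, h1, h2, h3⟩
  rw [e]
  exact isClosedMap_fst_of_compactSpace _ hS

/-- The deterministic core: if a subspace `V` is orthogonal to all shifted columns outside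
`{i} ∪ J`, then projecting the eigenvalue equation to `V` bounds the projection of column `i`. -/
lemma projection_column_le [DecidableEq ι] {V : Submodule ℂ (EuclideanSpace ℂ ι)} {y : ι × ι → ℂ}
    {x : EuclideanSpace ℂ ι} {z : ℂ} {i : ι} {J : Finset ι} (hi : i ∉ J) {c t ε B D T : ℝ}
    (hc : 0 ≤ c) (hε : ε ≤ t) (ht : 0 < t) (hz : ‖z‖ ≤ B) (hT : 0 ≤ T)
    (hV : ∀ j, j ≠ i → j ∉ J → V.orthogonalProjectionOnto
      (WithLp.toLp 2 (fun a => y (a, j)) - z • EuclideanSpace.single j 1) = 0)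
    (hD : D ≤ ‖∑ a, y (a, i) • V.orthogonalProjectionOnto (EuclideanSpace.single a 1)‖)
    (hJ : ∀ v : EuclideanSpace ℂ J, ‖columnComb
      (fun a => V.orthogonalProjectionOnto (EuclideanSpace.single a 1))
      (fun q : ι × J => y (q.1, q.2)) v‖ ≤ T * ‖v‖)
    (h1 : t ≤ ‖x i‖) (h2 : ∑ j ∈ J, ‖x j‖ ^ 2 ≤ c ^ 2 * ‖x i‖ ^ 2)
    (h3 : ‖WithLp.toLp 2 (fun a => ∑ j, y (a, j) * x j) - z • x‖ ≤ ε) :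
    D ≤ 1 + B + T * c + B * c := by
  set Q := V.orthogonalProjectionOnto
  set p : ι → V := fun a => Q (EuclideanSpace.single a 1) with hp
  have hexp : ∀ v : EuclideanSpace ℂ ι, Q v = ∑ a, v a • p a := by
    intro v
    conv_lhs => rw [← (EuclideanSpace.basisFun ι ℂ).sum_repr v]
    simp [hp]
  have hcol : ∀ j, Q (WithLp.toLp 2 (fun a => y (a, j))) = ∑ a, y (a, j) • p a := fun j => hexp _
  have hx : 0 < ‖x i‖ := ht.trans_le h1
  have hsum : WithLp.toLp 2 (fun a => ∑ j, y (a, j) * x j) - z • x =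
      ∑ j, x j • (WithLp.toLp 2 (fun a => y (a, j)) - z • EuclideanSpace.single j (1 : ℂ)) := by
    ext a
    simp [sub_mul, Finset.sum_sub_distrib, mul_comm, Pi.single_apply, ite_mul]
  have hQ : Q (WithLp.toLp 2 (fun a => ∑ j, y (a, j) * x j) - z • x) =
      x i • (∑ a, y (a, i) • p a) - (x i * z) • p i +
        ∑ j ∈ J, x j • (∑ a, y (a, j) • p a) - z • ∑ j ∈ J, x j • p j := by
    rw [hsum, map_sum]
    rw [← Finset.sum_subset (Finset.subset_univ (insert i J))]
    · rw [Finset.sum_insert hi]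
      simp_rw [map_smul, map_sub, map_smul, hcol, smul_sub]
      rw [Finset.sum_sub_distrib, Finset.smul_sum (r := z), mul_smul]
      simp_rw [smul_comm z]
      abel
    · intro j _ hj
      rw [Finset.mem_insert, not_or] at hj
      rw [map_smul, hV j hj.1 hj.2, smul_zero]
  let v : EuclideanSpace ℂ J := WithLp.toLp 2 fun j => x j
  have hv : ‖v‖ ≤ c * ‖x i‖ := by
    refine le_of_sq_le_sq ?_ (by positivity)
    rw [EuclideanSpace.norm_sq_eq, mul_pow]
    refine le_trans (le_of_eq ?_) h2
    exact Finset.sum_coe_sort J fun j => ‖x j‖ ^ 2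
  have hcomb : ‖∑ j ∈ J, x j • (∑ a, y (a, j) • p a)‖ ≤ T * (c * ‖x i‖) := by
    have := hJ v
    rw [columnComb, Finset.sum_coe_sort J fun j => x j • ∑ a, y (a, j) • p a] at this
    exact this.trans (by gcongr)
  have hshift : ‖∑ j ∈ J, x j • p j‖ ≤ c * ‖x i‖ := by
    have e : ∑ j ∈ J, x j • p j = Q (WithLp.toLp 2 fun j => if j ∈ J then x j else 0) := by
      rw [hexp]; simp [ite_smul, Finset.sum_ite_mem]
    rw [e]
    refine (V.norm_orthogonalProjectionOnto_apply_le _).trans ?_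
    refine le_of_sq_le_sq ?_ (by positivity)
    rw [EuclideanSpace.norm_sq_eq, mul_pow]
    refine le_trans (le_of_eq ?_) h2
    simp [apply_ite norm, Finset.sum_ite_mem]
  have hpi : ‖p i‖ ≤ 1 := by
    refine (V.norm_orthogonalProjectionOnto_apply_le _).trans ?_
    simp
  have hQn : ‖Q (WithLp.toLp 2 (fun a => ∑ j, y (a, j) * x j) - z • x)‖ ≤ ‖x i‖ :=
    (V.norm_orthogonalProjectionOnto_apply_le _).trans (h3.trans (hε.trans h1))
  have hmain : x i • (∑ a, y (a, i) • p a) =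
      Q (WithLp.toLp 2 (fun a => ∑ j, y (a, j) * x j) - z • x) + (x i * z) • p i -
        ∑ j ∈ J, x j • (∑ a, y (a, j) • p a) + z • ∑ j ∈ J, x j • p j := by
    rw [hQ]; abel
  have hB : 0 ≤ B := (norm_nonneg z).trans hz
  have hfin : ‖x i‖ * D ≤ ‖x i‖ * (1 + B + T * c + B * c) := by
    calc ‖x i‖ * D ≤ ‖x i • (∑ a, y (a, i) • p a)‖ := by rw [norm_smul]; gcongr
      _ ≤ ‖Q (WithLp.toLp 2 (fun a => ∑ j, y (a, j) * x j) - z • x)‖ + ‖(x i * z) • p i‖ +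
          ‖∑ j ∈ J, x j • (∑ a, y (a, j) • p a)‖ + ‖z • ∑ j ∈ J, x j • p j‖ := by
        rw [hmain]
        refine (norm_add_le _ _).trans ?_
        gcongr
        refine (norm_sub_le _ _).trans ?_
        gcongr
        exact norm_add_le _ _
      _ ≤ ‖x i‖ + (‖x i‖ * B) * 1 + T * (c * ‖x i‖) + B * (c * ‖x i‖) := by
        rw [norm_smul, norm_smul z, norm_mul]
        gcongr
      _ = _ := by ring
  exact le_of_mul_le_mul_left hfin hx

/-- Approximate eigenvectors that are concentrated at `i` relative to `J` are exponentially
unlikely in the size of `J`. -/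
lemma measure_approxEigenSet_le [DecidableEq ι] {κ L s c t ε B : ℝ} (hκ : 0 < κ) (hL : 0 ≤ L)
    (hs0 : 0 ≤ s) (hs : (4 * L + 512 * κ ^ 2) * s ≤ 1 / 4) (hs1 : s ≤ 1) (hc : 0 ≤ c) (hc1 : c ≤ 1)
    (hcκ : √(768 * κ) * c ≤ 1 / 4) (ht : 0 < t) (hε : ε ≤ t)
    {μ : Measure ℂ} [IsProbabilityMeasure μ] (hμ : SubgaussianLaw κ μ)
    (hμ' : SqNormLaplaceBound L μ) {z : ℂ} (hz : ‖z‖ ≤ B) {i : ι} {J : Finset ι} (hi : i ∉ J)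
    (hJ : 16 * (1 + 2 * B) ^ 2 ≤ J.card) :
    (Measure.pi fun _ : ι × ι => μ) (approxEigenSet z i J c t ε) ≤
      2 * eexp (-(s / 2) * J.card) := by
  have hB : 0 ≤ B := (norm_nonneg z).trans hz
  refine pi_le_of_mix_le μ (Finset.univ.filter fun q : ι × ι => q.2 = i ∨ q.2 ∈ J)
    (isClosed_approxEigenSet z i J c t ε).measurableSet _ fun w => ?_
  set I := Finset.univ.filter fun q : ι × ι => q.2 = i ∨ q.2 ∈ J with hI
  let u : ι → EuclideanSpace ℂ ι := fun j =>
    WithLp.toLp 2 (fun a => w (a, j)) - z • EuclideanSpace.single j 1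
  let W := Submodule.span ℂ (((insert i J)ᶜ.image u : Finset _) : Set (EuclideanSpace ℂ ι))
  have hd : J.card + 1 ≤ Module.finrank ℂ Wᗮ := by
    have h1 : Module.finrank ℂ W ≤ (insert i J)ᶜ.card :=
      (finrank_span_finset_le_card _).trans Finset.card_image_le
    have h2 := W.finrank_add_finrank_orthogonal
    rw [finrank_euclideanSpace] at h2
    rw [Finset.card_compl, Finset.card_insert_of_notMem hi] at h1
    have h3 : (insert i J).card ≤ Fintype.card ι := Finset.card_le_univ _
    rw [Finset.card_insert_of_notMem hi] at h3
    omega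
  have hdJ : (J.card : ℝ) + 1 ≤ (Module.finrank ℂ Wᗮ : ℝ) := by exact_mod_cast hd
  set d : ℝ := (Module.finrank ℂ Wᗮ : ℝ)
  have hfr := isParsevalFrame_projection Wᗮ
  set p := fun a => Wᗮ.orthogonalProjectionOnto (EuclideanSpace.single a (1 : ℂ)) with hp
  let S₁ : Set (ι → ℂ) := {x | ‖∑ a, x a • p a‖ ^ 2 ≤ d / 4}
  let S₂ : Set (ι × J → ℂ) := {y | ∃ v : EuclideanSpace ℂ J, ‖v‖ ≤ 1 ∧
      768 * κ * d < ‖columnComb p y v‖ ^ 2}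
  have hsub : {y | mix I (y, w) ∈ approxEigenSet z i J c t ε} ⊆
      (fun (y : ι × ι → ℂ) a => y (a, i)) ⁻¹' S₁ ∪
        (fun (y : ι × ι → ℂ) (q : ι × J) => y (q.1, q.2)) ⁻¹' S₂ := by
    intro y hy
    by_contra hn
    simp only [Set.mem_union, Set.mem_preimage, S₁, S₂, Set.mem_ofPred_eq, not_or, not_exists,
      not_and, not_le, not_lt] at hn
    obtain ⟨hn1, hn2⟩ := hn
    obtain ⟨x, -, h1, h2, h3⟩ := hy
    have hmem : ∀ a j, j = i ∨ j ∈ J → mix I (y, w) (a, j) = y (a, j) := fun a j h => by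
      simp [mix, hI, h]
    have hmem' : ∀ a j, ¬ (j = i ∨ j ∈ J) → mix I (y, w) (a, j) = w (a, j) := fun a j h => by
      simp [mix, hI, h]
    have hbound := projection_column_le (V := Wᗮ) (D := √d / 2) (T := √(768 * κ) * √d) hi hc hε ht
      hz (by positivity) ?_ ?_ ?_ h1 h2 h3
    -- The dimension is so large that the bound contradicts `D = √d / 2`.
    · have hd16 : (4 * (1 + 2 * B)) ^ 2 < d := by nlinarith
      have hd4 : 4 * (1 + 2 * B) < √d := Real.lt_sqrt_of_sq_lt hd16
      have h5 : √(768 * κ) * √d * c ≤ 1 / 4 * √d := by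
        calc _ = √(768 * κ) * c * √d := by ring
          _ ≤ _ := by gcongr
      have h6 : B * c ≤ B := mul_le_of_le_one_right hB hc1
      linarith
    · intro j hji hjJ
      simp_rw [hmem' _ j (not_or.2 ⟨hji, hjJ⟩)]
      refine Submodule.orthogonalProjectionOnto_orthogonal_apply_eq_zero ?_
      refine Submodule.subset_span ?_
      rw [Finset.coe_image]
      exact ⟨j, by simp [hji, hjJ], rfl⟩
    · simp_rw [hmem _ i (Or.inl rfl)]
      refine le_of_sq_le_sq ?_ (norm_nonneg _)
      rw [div_pow, Real.sq_sqrt (by positivity)]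
      refine le_trans (le_of_eq (by norm_num)) hn1.le
    · refine columnComb_le_mul fun v hv => ?_
      simp_rw [hmem _ _ (Or.inr (Subtype.coe_prop _))]
      rw [← Real.sqrt_mul (by positivity)]
      exact Real.le_sqrt_of_sq_le (hn2 v hv)
  have hS₁ : (Measure.pi fun _ : ι × ι => μ) ((fun (y : ι × ι → ℂ) a => y (a, i)) ⁻¹' S₁) ≤
      eexp (-(s / 2) * J.card) := by
    refine (Measure.le_map_apply
      (measurable_pi_lambda _ fun _ => measurable_pi_apply _).aemeasurable _).trans ?_
    rw [map_comp_pi μ (f := fun a : ι => (a, i)) (fun a b h => (Prod.mk.inj h).1)]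
    refine (hfr.measure_norm_sq_le hκ hL hμ hμ' hs0 hs hs1).trans (eexp_mono ?_)
    nlinarith
  have hS₂ : (Measure.pi fun _ : ι × ι => μ)
      ((fun (y : ι × ι → ℂ) (q : ι × J) => y (q.1, q.2)) ⁻¹' S₂) ≤
      eexp (-(s / 2) * J.card) := by
    refine (Measure.le_map_apply
      (measurable_pi_lambda _ fun _ => measurable_pi_apply _).aemeasurable _).trans ?_
    rw [map_comp_pi μ (f := fun q : ι × J => (q.1, (q.2 : ι))) (by
      rintro ⟨a, j⟩ ⟨b, k⟩ h
      simp only [Prod.mk.injEq] at h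
      exact Prod.ext h.1 (Subtype.ext h.2))]
    refine (hfr.measure_exists_columnComb_le hκ hμ (by simp; omega)).trans (eexp_mono ?_)
    have : (0 : ℝ) ≤ J.card := Nat.cast_nonneg _
    nlinarith
  calc _ ≤ _ := measure_mono hsub
    _ ≤ _ := measure_union_le _ _
    _ ≤ eexp (-(s / 2) * J.card) + eexp (-(s / 2) * J.card) := add_le_add hS₁ hS₂
    _ = _ := (two_mul _).symm

end Event

/-! ### Blocks of coordinates, the grid of eigenvalues, and the union bound -/

/-- The block with label `b` of a family of disjoint blocks of coordinates, all of the same size. -/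
def block {ι β ρ : Type*} [Fintype ρ] (e : β × ρ ↪ ι) (b : β) : Finset ι :=
  Finset.univ.map ⟨fun k => e (b, k), fun _ _ h => (Prod.mk.inj (e.injective h)).2⟩

lemma card_block {ι β ρ : Type*} [Fintype ρ] (e : β × ρ ↪ ι) (b : β) :
    (block e b).card = Fintype.card ρ := by
  simp [block]

lemma sum_block {ι β ρ : Type*} [Fintype ρ] (e : β × ρ ↪ ι) (b : β) (g : ι → ℝ) :
    ∑ j ∈ block e b, g j = ∑ k, g (e (b, k)) := by
  rw [block, Finset.sum_map]
  rfl

/-- Pigeonhole: if `|xᵢ|` is large, then some block avoiding `i` carries little of `x`. -/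
lemma exists_block_sum_le {ι β ρ : Type*} [Fintype ι] [Fintype β] [Fintype ρ] (e : β × ρ ↪ ι)
    (g : ι → ℝ) (hg : ∀ j, 0 ≤ g j) (hg1 : ∑ j, g j ≤ 1) (i : ι) {τ : ℝ} (hτ : 0 ≤ τ)
    (h : 1 < (Fintype.card β - 1) * τ) :
    ∃ b, i ∉ block e b ∧ ∑ j ∈ block e b, g j ≤ τ := by
  classical
  by_contra! hn
  set G := Finset.univ.filter fun b => i ∉ block e b
  -- The blocks are disjoint, so at most one of them contains `i`.
  have huniq : Gᶜ.card ≤ 1 := by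
    refine Finset.card_le_one.2 fun a ha b hb => ?_
    simp only [G, Finset.compl_filter, not_not, Finset.mem_filter, Finset.mem_univ, true_and, block,
      Finset.mem_map] at ha hb
    obtain ⟨k, hk⟩ := ha
    obtain ⟨l, hl⟩ := hb
    exact (Prod.mk.inj (e.injective (hk.trans hl.symm))).1
  have hcard : (Fintype.card β : ℝ) - 1 ≤ G.card := by
    have h1 := Finset.card_add_card_compl G
    have : Fintype.card β ≤ G.card + 1 := by omega
    have : (Fintype.card β : ℝ) ≤ G.card + 1 := by exact_mod_cast this
    linarith
  have hall : ∑ b, ∑ j ∈ block e b, g j ≤ 1 := by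
    simp_rw [sum_block]
    rw [← Fintype.sum_prod_type (f := fun q : β × ρ => g (e q))]
    refine le_trans ?_ hg1
    rw [← Finset.sum_map Finset.univ e g]
    exact Finset.sum_le_sum_of_subset_of_nonneg (Finset.subset_univ _) fun j _ _ => hg j
  have hG : (G.card : ℝ) * τ ≤ ∑ b ∈ G, ∑ j ∈ block e b, g j := by
    rw [← nsmul_eq_mul]
    exact Finset.card_nsmul_le_sum _ _ _ fun b hb =>
      (hn b (Finset.mem_filter.1 hb).2).le
  have hG' : ∑ b ∈ G, ∑ j ∈ block e b, g j ≤ ∑ b, ∑ j ∈ block e b, g j :=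
    Finset.sum_le_sum_of_subset_of_nonneg (Finset.subset_univ _) fun b _ _ =>
      Finset.sum_nonneg fun j _ => hg j
  have := mul_le_mul_of_nonneg_right hcard hτ
  linarith

/-- The point `(k + l i) / n` of a square grid. -/
noncomputable def gridPoint (n : ℕ) (q : ℤ × ℤ) : ℂ := ⟨q.1 / n, q.2 / n⟩

/-- The indices of the grid points used to cover the disc of radius `R`. -/
noncomputable def gridIndex (R : ℝ) (n : ℕ) : Finset (ℤ × ℤ) :=
  Finset.Icc (-⌈R * n⌉) ⌈R * n⌉ ×ˢ Finset.Icc (-⌈R * n⌉) ⌈R * n⌉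

/-- Rounding real and imaginary part down to multiples of `1 / n`. -/
lemma exists_gridPoint {R : ℝ} {n : ℕ} (hn : 0 < n) {z : ℂ} (hz : ‖z‖ ≤ R) :
    ∃ q ∈ gridIndex R n, ‖z - gridPoint n q‖ ≤ 2 / n := by
  have hn' : (0 : ℝ) < n := by exact_mod_cast hn
  have hmem : ∀ a : ℝ, |a| ≤ R → ⌊a * n⌋ ∈ Finset.Icc (-⌈R * n⌉) ⌈R * n⌉ := by
    intro a ha
    rw [Finset.mem_Icc]
    constructor
    · rw [Int.le_floor]
      push_cast
      have := Int.le_ceil (R * n)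
      nlinarith [neg_abs_le a]
    · refine Int.cast_le.1 ((Int.floor_le (a * n)).trans (le_trans ?_ (Int.le_ceil (R * n))))
      gcongr
      exact (le_abs_self a).trans ha
  have hdist : ∀ a : ℝ, |a - ⌊a * n⌋ / n| ≤ 1 / n := by
    intro a
    have h1 := Int.floor_le (a * n)
    have h2 := Int.lt_floor_add_one (a * n)
    have e : a - ⌊a * n⌋ / n = (a * n - ⌊a * n⌋) / n := by field_simp
    rw [e, abs_of_nonneg (div_nonneg (by linarith) hn'.le)]
    gcongr
    linarith
  refine ⟨(⌊z.re * n⌋, ⌊z.im * n⌋), Finset.mem_product.2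
    ⟨hmem _ ((Complex.abs_re_le_norm z).trans hz),
      hmem _ ((Complex.abs_im_le_norm z).trans hz)⟩, ?_⟩
  refine (Complex.norm_le_abs_re_add_abs_im _).trans ?_
  have h1 := hdist z.re
  have h2 := hdist z.im
  simp only [gridPoint, Complex.sub_re, Complex.sub_im]
  calc _ ≤ 1 / (n : ℝ) + 1 / n := add_le_add h1 h2
    _ = _ := by ring

lemma norm_gridPoint_le {R : ℝ} {n : ℕ} (hn : 0 < n) {q : ℤ × ℤ} (hq : q ∈ gridIndex R n) :
    ‖gridPoint n q‖ ≤ 2 * (R + 1) := by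
  have hn' : (1 : ℝ) ≤ n := by exact_mod_cast hn
  have h : ∀ k ∈ Finset.Icc (-⌈R * n⌉) ⌈R * n⌉, |(k : ℝ) / n| ≤ R + 1 := by
    intro k hk
    rw [Finset.mem_Icc] at hk
    have h1 : |(k : ℝ)| ≤ ⌈R * n⌉ := by exact_mod_cast abs_le.2 hk
    rw [abs_div, abs_of_nonneg (by positivity : (0 : ℝ) ≤ n), div_le_iff₀ (by positivity)]
    have := (Int.ceil_lt_add_one (R * n)).le
    nlinarith
  obtain ⟨h1, h2⟩ := Finset.mem_product.1 hq
  refine (Complex.norm_le_abs_re_add_abs_im _).trans ?_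
  have h3 := h _ h1
  have h4 := h _ h2
  simp only [gridPoint]
  linarith

lemma card_gridIndex_le {R : ℝ} (hR : 0 ≤ R) {n : ℕ} (hn : 0 < n) :
    ((gridIndex R n).card : ℝ) ≤ ((2 * R + 3) * n) ^ 2 := by
  have hn' : (1 : ℝ) ≤ n := by exact_mod_cast hn
  have h0 : 0 ≤ ⌈R * n⌉ := Int.ceil_nonneg (by positivity)
  have h1 : (((Finset.Icc (-⌈R * n⌉) ⌈R * n⌉).card : ℕ) : ℝ) ≤ (2 * R + 3) * n := by
    rw [Int.card_Icc]
    have : (((⌈R * n⌉ + 1 - -⌈R * n⌉).toNat : ℤ) : ℝ) = 2 * ⌈R * n⌉ + 1 := by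
      rw [Int.toNat_of_nonneg (by omega)]; push_cast; ring
    rw [Int.cast_natCast] at this
    rw [this]
    have := (Int.ceil_lt_add_one (R * n)).le
    nlinarith
  rw [gridIndex, Finset.card_product, sq]
  push_cast
  gcongr

/-- A matrix with a delocalization failure belongs to one of finitely many events. -/
lemma mem_approxEigenSet_of_not_bounded {n m r : ℕ} (hn : 0 < n) (e : Fin m × Fin r ↪ Fin n)
    {A : Matrix (Fin n) (Fin n) ℂ} {R c t : ℝ} (hc : 0 < c) (ht : 0 < t)
    (hm : 1 ≤ ((m : ℝ) - 1) * (c ^ 2 * t ^ 2)) (hA : ¬ SmallEigenvectorsBounded A R t) :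
    ∃ q ∈ gridIndex R n, ∃ i b, i ∉ block e b ∧
      (fun p : Fin n × Fin n => A p.1 p.2) ∈
        approxEigenSet (gridPoint n q) i (block e b) c t (2 / n) := by
  unfold SmallEigenvectorsBounded at hA
  push Not at hA
  obtain ⟨lam, x, hlam, hx, hev, hbig⟩ := hA
  obtain ⟨i, hi⟩ : ∃ i, t < ‖x i‖ := by
    by_contra! h
    exact absurd ((pi_norm_le_iff_of_nonneg ht.le).2 h) (not_le.2 hbig)
  have hsum : ∑ j, ‖x j‖ ^ 2 = 1 := by
    rw [← EuclideanSpace.norm_sq_eq, hx, one_pow]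
  have hm1 : 0 < (m : ℝ) - 1 := by
    by_contra! h
    have : ((m : ℝ) - 1) * (c ^ 2 * t ^ 2) ≤ 0 :=
      mul_nonpos_of_nonpos_of_nonneg h (by positivity)
    linarith
  obtain ⟨b, hib, hb⟩ := exists_block_sum_le e (fun j => ‖x j‖ ^ 2) (fun j => by positivity)
    hsum.le i (τ := c ^ 2 * ‖x i‖ ^ 2) (by positivity) (by
      rw [Fintype.card_fin]
      refine hm.trans_lt ?_
      gcongr)
  obtain ⟨q, hq, hqd⟩ := exists_gridPoint (n := n) hn hlam
  refine ⟨q, hq, i, b, hib, x, hx, hi.le, hb, ?_⟩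
  have hAx : (WithLp.toLp 2 fun a => ∑ j, A a j * x j) = lam • x := by
    ext a
    have := congrFun hev.apply_eq_smul a
    simpa [Matrix.mulVec, dotProduct] using this
  change ‖(WithLp.toLp 2 fun a => ∑ j, A a j * x j) - gridPoint n q • x‖ ≤ 2 / n
  rw [hAx, ← sub_smul, norm_smul, hx, mul_one]
  exact hqd

/-- `m` disjoint blocks of size `r` inside `Fin n`. -/
def blockEmbedding {m r n : ℕ} (h : m * r ≤ n) : Fin m × Fin r ↪ Fin n :=
  finProdFinEquiv.toEmbedding.trans (Fin.castLEEmb h)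

/-- Union bound over grid points, coordinates and blocks. -/
lemma measure_not_bounded_le {n m r : ℕ} (hn : 0 < n) (hmr : m * r ≤ n)
    {κ L s c t R : ℝ} (hR : 0 ≤ R) (hκ : 0 < κ) (hL : 0 ≤ L) (hs0 : 0 ≤ s)
    (hs : (4 * L + 512 * κ ^ 2) * s ≤ 1 / 4) (hs1 : s ≤ 1) (hc : 0 < c) (hc1 : c ≤ 1)
    (hcκ : √(768 * κ) * c ≤ 1 / 4) (ht : 0 < t) (hε : 2 / n ≤ t)
    (hm : 1 ≤ ((m : ℝ) - 1) * (c ^ 2 * t ^ 2))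
    (hr : 16 * (1 + 2 * (2 * (R + 1))) ^ 2 ≤ r)
    {μ : Measure ℂ} [IsProbabilityMeasure μ] (hμ : SubgaussianLaw κ μ)
    (hμ' : SqNormLaplaceBound L μ)
    {Ω : Type*} [MeasurableSpace Ω] {P : Measure Ω} {M : Ω → Matrix (Fin n) (Fin n) ℂ}
    (hM : AEMeasurable (fun ω (p : Fin n × Fin n) => M ω p.1 p.2) P)
    (hlaw : P.map (fun ω (p : Fin n × Fin n) => M ω p.1 p.2) = Measure.pi fun _ => μ) :
    P {ω | ¬ SmallEigenvectorsBounded (M ω) R t} ≤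
      ENNReal.ofReal (((2 * R + 3) * n) ^ 2 * n * m * (2 * Real.exp (-(s / 2) * r))) := by
  set e := blockEmbedding hmr
  let T := (gridIndex R n ×ˢ (Finset.univ : Finset (Fin n × Fin m))).filter
    fun w => w.2.1 ∉ block e w.2.2
  let S : (ℤ × ℤ) × Fin n × Fin m → Set (Fin n × Fin n → ℂ) := fun w =>
    approxEigenSet (gridPoint n w.1) w.2.1 (block e w.2.2) c t (2 / n)
  have hmeas : MeasurableSet (⋃ w ∈ T, S w) :=
    T.measurableSet_biUnion fun w _ => (isClosed_approxEigenSet _ _ _ _ _ _).measurableSet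
  have hsub : {ω | ¬ SmallEigenvectorsBounded (M ω) R t} ⊆
      (fun ω (p : Fin n × Fin n) => M ω p.1 p.2) ⁻¹' ⋃ w ∈ T, S w := by
    intro ω hω
    obtain ⟨q, hq, i, b, hib, hmem⟩ := mem_approxEigenSet_of_not_bounded hn e hc ht hm hω
    exact Set.mem_biUnion (x := (q, i, b))
      (Finset.mem_coe.2 (Finset.mem_filter.2 ⟨by simp [hq], hib⟩)) hmem
  have hcard : (T.card : ℝ) ≤ ((2 * R + 3) * n) ^ 2 * n * m := by
    have h1 : T.card ≤ (gridIndex R n).card * (n * m) := by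
      refine (Finset.card_filter_le _ _).trans (le_of_eq ?_)
      rw [Finset.card_product]; simp
    calc (T.card : ℝ) ≤ (gridIndex R n).card * (n * m) := by exact_mod_cast h1
      _ ≤ ((2 * R + 3) * n) ^ 2 * (n * m) := by gcongr; exact card_gridIndex_le hR hn
      _ = _ := by ring
  calc P {ω | ¬ SmallEigenvectorsBounded (M ω) R t}
      ≤ (Measure.pi fun _ => μ) (⋃ w ∈ T, S w) := by
        rw [← hlaw, Measure.map_apply_of_aemeasurable hM hmeas]
        exact measure_mono hsub
    _ ≤ ∑ w ∈ T, (Measure.pi fun _ => μ) (S w) := measure_biUnion_finset_le _ _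
    _ ≤ ∑ _w ∈ T, 2 * eexp (-(s / 2) * r) := by
        refine Finset.sum_le_sum fun w hw => ?_
        obtain ⟨hw1, hw2⟩ := Finset.mem_filter.1 hw
        have hcb : (block e w.2.2).card = r := by rw [card_block, Fintype.card_fin]
        have := measure_approxEigenSet_le hκ hL hs0 hs hs1 hc.le hc1 hcκ ht hε hμ hμ'
          (norm_gridPoint_le hn (Finset.mem_product.1 hw1).1) hw2 (by rw [hcb]; exact hr)
        rwa [hcb] at this
    _ = ENNReal.ofReal (T.card * (2 * Real.exp (-(s / 2) * r))) := by
        rw [Finset.sum_const, nsmul_eq_mul, ENNReal.ofReal_mul (by positivity),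
          ENNReal.ofReal_mul (by positivity), ENNReal.ofReal_natCast, ENNReal.ofReal_ofNat, eexp]
    _ ≤ _ := by gcongr

/-! ### Choice of the block size -/

lemma eventually_log_conditions {A : ℝ} (hA : 0 < A) (B D : ℝ) :
    ∀ᶠ n : ℕ in Filter.atTop, 1 ≤ Real.log n ∧ B ≤ A * Real.log n ∧ D ≤ n ∧
      4 * (A * Real.log n + 1) ≤ n := by
  have hlog : Filter.Tendsto (fun n : ℕ => Real.log n) Filter.atTop Filter.atTop :=
    Real.tendsto_log_atTop.comp tendsto_natCast_atTop_atTop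
  have ho := (Real.isLittleO_log_id_atTop.comp_tendsto
    (tendsto_natCast_atTop_atTop (R := ℝ))).bound (show (0 : ℝ) < 1 / (8 * A) by positivity)
  filter_upwards [hlog.eventually_ge_atTop 1, hlog.eventually_ge_atTop (B / A),
    (tendsto_natCast_atTop_atTop (R := ℝ)).eventually_ge_atTop D,
    (tendsto_natCast_atTop_atTop (R := ℝ)).eventually_ge_atTop 8, ho] with n h1 h2 h3 h4 h5
  refine ⟨h1, (div_le_iff₀' hA).1 h2, h3, ?_⟩
  simp only [Function.comp_apply, id, Real.norm_eq_abs, Nat.abs_cast] at h5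
  have h6 := (le_abs_self _).trans h5
  have h7 : A * Real.log n ≤ n / 8 := by
    calc A * Real.log n ≤ A * (1 / (8 * A) * n) := by gcongr
      _ = n / 8 := by field_simp
  linarith

/-- The entries of a random matrix with independent entries have a product law. -/
lemma HasIIDEntries.map_eq {Ω₀ Ω : Type*} [MeasurableSpace Ω₀] [MeasurableSpace Ω] {n : ℕ}
    {M : Ω → Matrix (Fin n) (Fin n) ℂ} {P : Measure Ω} [IsProbabilityMeasure P] {ξ : Ω₀ → ℂ}
    {P₀ : Measure Ω₀} (h : HasIIDEntries M P ξ P₀) :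
    AEMeasurable (fun ω (p : Fin n × Fin n) => M ω p.1 p.2) P ∧
      P.map (fun ω (p : Fin n × Fin n) => M ω p.1 p.2) = Measure.pi fun _ => P₀.map ξ := by
  have hm : ∀ p : Fin n × Fin n, AEMeasurable (fun ω => M ω p.1 p.2) P :=
    fun p => (h.2 p.1 p.2).aemeasurable_fst
  refine ⟨aemeasurable_pi_lambda _ hm, ?_⟩
  rw [(iIndepFun_iff_map_fun_eq_pi_map hm).1 h.1]
  congr 1
  ext1 p
  exact (h.2 p.1 p.2).map_eq

theorem theorem1p7 (K₀ c₀ : ℝ) (hK₀ : 1 < K₀) (hc₀ : 0 < c₀) (R : ℝ) (hR : 0 < R)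
    (K : ℝ) (hK : 0 < K) :
    ∃ C : ℝ, 0 < C ∧ ∃ n₀ : ℕ, ∀ n : ℕ, n₀ ≤ n →
      ∀ (Ω₀ : Type*) [MeasurableSpace Ω₀] (P₀ : Measure Ω₀) [IsProbabilityMeasure P₀]
        (ξ : Ω₀ → ℂ), IsNormalized ξ P₀ → IsSubgaussianWith K₀ c₀ ξ P₀ →
      ∀ (Ω : Type*) [MeasurableSpace Ω] (P : Measure Ω) [IsProbabilityMeasure P]
        (M : Ω → Matrix (Fin n) (Fin n) ℂ), HasIIDEntries M P ξ P₀ →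
        P {ω | ¬ SmallEigenvectorsBounded (M ω) R (C * Real.sqrt (Real.log n / n))} ≤
          ENNReal.ofReal ((n : ℝ) ^ (-K)) := by
  have hK₀' : 0 < K₀ := by linarith
  set κ := 2 * K₀ * (1 + c₀)
  set L := 8 * K₀ ^ 2 * (1 + c₀)
  have hκ : 0 < κ := by positivity
  have hL : 0 ≤ L := by positivity
  -- `s` is the decay rate of the small ball estimate.
  obtain ⟨s, hs0, hs, hs1⟩ : ∃ s : ℝ, 0 < s ∧ (4 * L + 512 * κ ^ 2) * s ≤ 1 / 4 ∧ s ≤ 1 := by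
    refine ⟨1 / (4 * (4 * L + 512 * κ ^ 2) + 1), by positivity, ?_, ?_⟩
    · rw [mul_one_div, div_le_iff₀ (by positivity)]; linarith
    · exact div_le_one_of_le₀ (by nlinarith [sq_nonneg κ]) (by positivity)
  obtain ⟨c, hc0, hc1, hcκ⟩ : ∃ c : ℝ, 0 < c ∧ c ≤ 1 ∧ √(768 * κ) * c ≤ 1 / 4 := by
    refine ⟨1 / (4 * √(768 * κ) + 1), by positivity, ?_, ?_⟩
    · exact div_le_one_of_le₀ (by nlinarith [Real.sqrt_nonneg (768 * κ)]) (by positivity)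
    · rw [mul_one_div, div_le_iff₀ (by positivity)]; linarith
  -- With blocks of size about `A log n`, each event of the union bound has probability at most
  -- `2 n ^ (-(K + 5))`, and there are `O(n ^ 4)` of them.
  set A := 2 * (K + 5) / s with hA_def
  have hA10 : 10 ≤ A := by
    rw [hA_def, le_div_iff₀ hs0]; nlinarith
  have hA : 0 < A := by linarith
  set C := 2 * √A / c with hC_def
  have hC : 0 < C := by positivity
  have hC2 : c ^ 2 * C ^ 2 = 4 * A := by
    rw [hC_def, div_pow, mul_pow, Real.sq_sqrt hA.le]; field_simp; norm_num
  obtain ⟨n₀, hn₀⟩ := Filter.eventually_atTop.1 (eventually_log_conditions hA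
    (16 * (1 + 2 * (2 * (R + 1))) ^ 2) (2 * (2 * R + 3) ^ 2))
  refine ⟨C, hC, n₀, fun n hn Ω₀ _ P₀ _ ξ hξ hsub Ω _ P _ M hM => ?_⟩
  obtain ⟨h1, h2, h3, h4⟩ := hn₀ n hn
  have hn0 : 0 < n := by
    rcases Nat.eq_zero_or_pos n with rfl | h
    · norm_num at h1
    · exact h
  have hn0' : (0 : ℝ) < n := by exact_mod_cast hn0
  have hn1' : (1 : ℝ) ≤ n := by exact_mod_cast hn0
  obtain ⟨hμ, hμ'⟩ := hξ.laws hK₀' hc₀.le hsub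
  have := Measure.isProbabilityMeasure_map hξ.moments.1
  obtain ⟨hMm, hMl⟩ := hM.map_eq
  set ℓ := Real.log n
  set r := ⌈A * ℓ⌉₊
  set m := n / r
  have hr1 : A * ℓ ≤ r := Nat.le_ceil _
  have hr2 : (r : ℝ) ≤ A * ℓ + 1 := (Nat.ceil_lt_add_one (by positivity)).le
  have hAl : 1 ≤ A * ℓ := by nlinarith
  have hr0 : (0 : ℝ) < r := by linarith
  have hm : (n : ℝ) / r - 1 ≤ m := by
    have h := Nat.lt_floor_add_one ((n : ℝ) / r)
    rw [Nat.floor_div_eq_div] at h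
    linarith
  have hmn : (m : ℝ) ≤ n := by exact_mod_cast Nat.div_le_self n r
  set t := C * √(ℓ / n)
  have ht : 0 < t := by positivity
  have ht2 : c ^ 2 * t ^ 2 = 4 * A * (ℓ / n) := by
    simp only [t]
    rw [mul_pow, Real.sq_sqrt (by positivity), ← mul_assoc, hC2]
  have hsqrtA : 1 ≤ √A := Real.one_le_sqrt.2 (by linarith)
  have hC2' : 2 ≤ C := by
    rw [hC_def, le_div_iff₀ hc0]; linarith
  have hε : 2 / (n : ℝ) ≤ t := by
    have : 1 / (n : ℝ) ≤ √(ℓ / n) := by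
      refine Real.le_sqrt_of_sq_le ?_
      rw [div_pow, one_pow, div_le_div_iff₀ (by positivity) hn0']
      nlinarith
    calc 2 / (n : ℝ) = 2 * (1 / n) := by ring
      _ ≤ C * √(ℓ / n) := by gcongr
  have hmt : 1 ≤ ((m : ℝ) - 1) * (c ^ 2 * t ^ 2) := by
    have h5 : (n : ℝ) / (2 * r) ≤ m - 1 := by
      have : 2 ≤ (n : ℝ) / (2 * r) := by
        rw [le_div_iff₀ (by positivity)]; linarith
      have e : (n : ℝ) / r = 2 * (n / (2 * r)) := by field_simp
      linarith
    rw [ht2]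
    calc 1 ≤ (n : ℝ) / (2 * r) * (4 * A * (ℓ / n)) := by
          have e : (n : ℝ) / (2 * r) * (4 * A * (ℓ / n)) = 2 * (A * ℓ) / r := by
            field_simp; norm_num
          rw [e, le_div_iff₀ hr0]; linarith
      _ ≤ _ := by gcongr
  refine (measure_not_bounded_le hn0 (Nat.div_mul_le_self n r) hR.le hκ hL hs0.le hs hs1 hc0 hc1
    hcκ ht hε hmt (h2.trans hr1) hμ hμ' hMm hMl).trans (ENNReal.ofReal_le_ofReal ?_)
  have hexp : Real.exp (-(s / 2) * r) ≤ (n : ℝ) ^ (-(K + 5)) := by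
    rw [Real.rpow_def_of_pos hn0']
    refine Real.exp_le_exp.2 ?_
    have : s / 2 * (A * ℓ) = ℓ * (K + 5) := by rw [hA_def]; field_simp
    nlinarith [mul_le_mul_of_nonneg_left hr1 (show 0 ≤ s / 2 by positivity)]
  calc ((2 * R + 3) * n) ^ 2 * n * m * (2 * Real.exp (-(s / 2) * r))
      ≤ ((2 * R + 3) * n) ^ 2 * n * n * (2 * (n : ℝ) ^ (-(K + 5))) := by gcongr
    _ = (2 * (2 * R + 3) ^ 2) * (n ^ 4 * (n : ℝ) ^ (-(K + 5))) := by ring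
    _ ≤ n * (n ^ 4 * (n : ℝ) ^ (-(K + 5))) := by gcongr
    _ = (n : ℝ) ^ (-K) := by
        rw [← mul_assoc, ← pow_succ', ← Real.rpow_natCast, ← Real.rpow_add hn0']
        congr 1
        push_cast; ring
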